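/- **Setting.** Let $(\mathcal A,\mathcal T,\mathcal G)$ be a regularity structure: $\mathcal A\subset\mathbb R$ is locally finite and bounded below, $\mathcal T=\bigoplus_{\zeta\in\mathcal A}\mathcal T_\zeta$ is graded by normed spaces, and $\mathcal G$ is a group of continuous linear maps with $\Gamma\tau-\tau\in\mathcal T_{<\zeta}$ for $\Gamma\in\mathcal G$, $\tau\in\mathcal T_\zeta$. Write $|\tau|_\zeta$ for the norm of the component of $\tau$ in $\mathcal T_\zeta$. On $\mathbb R\times\mathbb R^d$ write $z=(t,x)$ and $|z|=\max(|t|^{1/2},|x_1|,\dots,|x_d|)$. A model $(\Pi,\Gamma)$ consists of linear maps $\Pi_z$ from $\mathcal T$ to distributions and of $\Gamma_{z,z'}\in\mathcal G$ with $\Gamma_{x,y}\Gamma_{y,z}=\Gamma_{x,z}$, $\Pi_z\Gamma_{z,z'}=\Pi_{z'}$, such that, for every bounded $K$ and every $c\in\mathbb R$, one has $|\langle\Pi_z\tau,\varphi^\lambda_z\rangle|\lesssim|\tau|\lambda^{\zeta}$ and $|\Gamma_{z,z'}\tau|_\nu\lesssim|\tau||z-z'|^{\zeta-\nu}$, uniformly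 over $z,z'\in K$ with $|z-z'|\le1$, $\lambda\in(0,1]$, $\nu\le\zeta<c$, $\tau\in\mathcal T_\zeta$, and smooth $\varphi$ supported in the unit ball with derivatives of parabolic order $<r$ bounded by $1$ ($r$ a fixed integer). In the definitions below functions over $\mathbb T^d$ are integrated over the cell $[0,1)^d$. For $\gamma,\eta\in\mathbb R$, $T>0$, $p\in(0,\infty]$ and maps $f,g$ put $$\|f-g\|_{\gamma,\eta,p}=\sup_{\zeta<\gamma}\Big\|\frac{|f(z)-g(z)|_\zeta}{t^{(\eta-\zeta)/2}}\Big\|_{L^p((0,T)\times\mathbb T^d)},$$ $$|||f|||_{\gamma,\eta,p}=\|f-0\|_{\gamma,\eta,p}+\sup_{\zeta<\gamma}\sup_{|h|<1}\Big\|\frac{|f(z+h)-\Gamma_{z+h,z}f(z)|_\zeta}{|h|^{\gamma-\zeta}t^{(\eta-\gamma)/2}}\Big\|_{L^p((3|h|^2,T-|h|^2)\times\mathbb T^d)},$$ and, for two models $(\Pi,\Gamma)$, $(\bar\Pi,\bar\Gamma)$, $$|||f;g|||_{\gamma,\eta,p}=\|f-g\|_{\gamma,\eta,p}+\sup_{\zeta<\gamma}\sup_{|h|<1}\Big\|\frac{|f(z+h)-g(z+h)-\Gamma_{z+h,z}f(z)+\bar\Gamma_{z+h,z}g(z)|_\zeta}{|h|^{\gamma-\zeta}t^{(\eta-\gamma)/2}}\Big\|_{L^p((3|h|^2,T-|h|^2)\times\mathbb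 T^d)}.$$ $\mathcal D^{\gamma,\eta,T}_p$ is the space of measurable maps $f:(0,T)\times\mathbb R^d\to\mathcal T_{<\gamma}$, $1$-periodic in each space variable, with $|||f|||_{\gamma,\eta,p}<\infty$; $\bar{\mathcal D}^{\gamma,\eta,T}_p$ is the same space for $(\bar\Pi,\bar\Gamma)$ (with $\bar\Gamma$ in place of $\Gamma$ in the norm), and $(V)$ indicates the maps with values in $V$. A sector of regularity $\alpha\in\mathbb R$ is a graded subspace $V=\bigoplus_\zeta V_\zeta$, $V_\zeta\subset\mathcal T_\zeta$, invariant under $\mathcal G$ and with $V_\zeta=0$ for $\zeta<\alpha$. Let $V_1,V_2$ be sectors of regularities $\alpha_1,\alpha_2$ with a product, i.e. a bilinear map $V_1\times V_2\to\mathcal T$ that is continuous on each pair of levels and maps $V_{1,\zeta_1}\times V_{2,\zeta_2}$ to $\mathcal T_{\zeta_1+\zeta_2}$ (to $0$ if $\zeta_1+\zeta_2\notin\mathcal A$). The pair is $\gamma$-regular if $\Gamma(\tau_1\tau_2)=(\Gamma\tau_1)(\Gamma\tau_2)$ for all $\Gamma\in\mathcal G$ and $\tau_i\in V_{i,\zeta_i}$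 with $\zeta_1+\zeta_2<\gamma$. Let $\|\Gamma\|$ be the supremum of $|\Gamma_{z,z'}\tau|_\nu/(|\tau||z-z'|^{\zeta-\nu})$ over $z,z'\in(0,T)\times[-1,2]^d$ with $|z-z'|\le1$, $\nu\le\zeta<\gamma_1\vee\gamma_2$ and $\tau\in\mathcal T_\zeta$ (for periodic models this is the supremum over $(0,T)\times\mathbb R^d$), and define $\|\bar\Gamma\|$ and $\|\Gamma-\bar\Gamma\|$ likewise. **Theorem.** Let $\gamma_i,\eta_i\in\mathbb R$, $p_i\in[1,\infty]$ for $i=1,2$, and $$\gamma=(\gamma_1+\alpha_2)\wedge(\gamma_2+\alpha_1),\qquad\eta=\eta_1+\eta_2,\qquad\frac1p=\frac1{p_1}+\frac1{p_2},$$ and let the pair $V_1,V_2$ be $\gamma$-regular. 1. If $f_i\in\mathcal D^{\gamma_i,\eta_i,T}_{p_i}(V_i)$ for $i=1,2$, then the product $f_1f_2$, projected to $\mathcal T_{<\gamma}$, belongs to $\mathcal D^{\gamma,\eta,T}_p$. 2. There is a constant $C$, which depends neither on $T$ nor on the models, such that for all $T>0$, all models $(\Pi,\Gamma)$, $(\bar\Pi,\bar\Gamma)$,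 all $f_i\in\mathcal D^{\gamma_i,\eta_i,T}_{p_i}(V_i)$ and all $g_i\in\bar{\mathcal D}^{\gamma_i,\eta_i,T}_{p_i}(V_i)$ (the products being projected to $\mathcal T_{<\gamma}$, the norms of $f_i,g_i$ having the indices $\gamma_i,\eta_i,p_i$ and the one on the left $\gamma,\eta,p$) $$\begin{aligned}|||f_1f_2;g_1g_2|||\le C\Big(&\|\Gamma\|^2\|f_1-g_1\|\,|||f_2|||+\|\Gamma-\bar\Gamma\|\big((\|\Gamma\|+\|\bar\Gamma\|)|||g_1|||\,|||f_2|||+|||g_2|||\,|||f_1|||\big)+|||f_1;g_1|||\,|||f_2|||\\&+\|\Gamma\|\,|||f_1|||\,|||f_2;g_2|||+(1+\|\bar\Gamma\|^2)|||g_1|||\,\|f_2-g_2\|+\|\bar\Gamma\|\,\|f_1-g_1\|\,|||g_2|||\Big).\end{aligned}$$ In particular, for given models (or uniformly over models with $\|\Gamma\|,\|\bar\Gamma\|$ bounded by a given number), $$\begin{aligned}|||f_1f_2;g_1g_2|||\lesssim{}&\|\Gamma\|^2\|f_1-g_1\|\,|||f_2|||+\|\Gamma-\bar\Gamma\|\big(|||g_1|||\,|||f_2|||+|||g_2|||\,|||f_1|||\big)+|||f_1;g_1|||\,|||f_2|||\\&+\|\Gamma\|\,|||f_1|||\,|||f_2;g_2|||+|||g_1|||\,\|f_2-g_2\|+\|\bar\Gamma\|\,\|f_1-g_1\|\,|||g_2|||,\end{aligned}$$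 uniformly over all $f_i\in\mathcal D^{\gamma_i,\eta_i,T}_{p_i}(V_i)$ and all $g_i\in\bar{\mathcal D}^{\gamma_i,\eta_i,T}_{p_i}(V_i)$. -/

import Mathlib

open MeasureTheory Set
open scoped ENNReal NNReal Distributions

universe u

noncomputable section

/-- A regularity structure `(A, T, G)`: `A` is a locally finite set of homogeneities which is bounded
from below, `T = ⨁_{ζ ∈ A} T_ζ` is graded by normed spaces, and `G` is a group of continuous linear
maps of `T` such that `Γ τ - τ` only has components of homogeneity `< ζ` whenever `τ ∈ T_ζ`. -/
structure RegularityStructure where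
  /-- the set of homogeneities -/
  A : Set ℝ
  bddBelow : BddBelow A
  locallyFinite : ∀ a b : ℝ, (A ∩ Icc a b).Finite
  /-- the space `T_ζ` -/
  Level : A → Type u
  [normedAddCommGroup : ∀ ζ, NormedAddCommGroup (Level ζ)]
  [normedSpace : ∀ ζ, NormedSpace ℝ (Level ζ)]
  /-- the structure group -/
  G : Subgroup ((Π₀ ζ, Level ζ) ≃ₗ[ℝ] (Π₀ ζ, Level ζ))
  continuous_of_mem : ∀ Γ ∈ G, ∀ ζ ν : A,
    Continuous fun τ : Level ζ => Γ (DFinsupp.single ζ τ) ν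
  triangular : ∀ Γ ∈ G, ∀ (ζ : A) (τ : Level ζ) (ν : A), ζ ≤ ν →
    (Γ (DFinsupp.single ζ τ) - DFinsupp.single ζ τ) ν = 0

attribute [instance] RegularityStructure.normedAddCommGroup RegularityStructure.normedSpace

namespace RegularityStructure

/-- The graded space `T`, the algebraic direct sum of the `T_ζ`. For `τ : R.Space`, the component
`τ ζ` is the projection of `τ` to `T_ζ`, and `‖τ ζ‖` is `|τ|_ζ`. -/
abbrev Space (R : RegularityStructure.{u}) : Type u := Π₀ ζ : R.A, R.Level ζ

/-- The projection of `T` to `T_{<γ}`. -/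
def trunc (R : RegularityStructure.{u}) (γ : ℝ) (τ : R.Space) : R.Space :=
  τ.filter fun ζ => (ζ : ℝ) < γ

end RegularityStructure

/-- A sector of regularity `α`: a graded subspace `V = ⨁ V_ζ` of `T` which is invariant under the
structure group and has no component of homogeneity below `α`. -/
structure Sector (R : RegularityStructure.{u}) (α : ℝ) where
  /-- the space `V_ζ`, a subspace of `T_ζ` -/
  V : ∀ ζ : R.A, Submodule ℝ (R.Level ζ)
  eq_bot : ∀ ζ : R.A, (ζ : ℝ) < α → V ζ = ⊥
  invariant : ∀ Γ ∈ R.G, ∀ (ζ : R.A), ∀ τ ∈ V ζ, ∀ ν : R.A, Γ (DFinsupp.single ζ τ) ν ∈ V ν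

/-- A product on a pair of sectors: a bilinear map which is continuous on each pair of levels and
adds homogeneities. Only the values on `V₁ × V₂` are used: the bilinear map is defined on `T × T`
for convenience, and every bilinear map from `V₁ × V₂` to `T` has such an extension. -/
structure SectorProduct {R : RegularityStructure.{u}} {α₁ α₂ : ℝ}
    (V₁ : Sector R α₁) (V₂ : Sector R α₂) where
  mul : R.Space →ₗ[ℝ] R.Space →ₗ[ℝ] R.Space
  homogeneous : ∀ (ζ₁ ζ₂ : R.A), ∀ τ₁ ∈ V₁.V ζ₁, ∀ τ₂ ∈ V₂.V ζ₂, ∀ ν : R.A,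
    (ν : ℝ) ≠ ζ₁ + ζ₂ → mul (DFinsupp.single ζ₁ τ₁) (DFinsupp.single ζ₂ τ₂) ν = 0
  continuous : ∀ ζ₁ ζ₂ ν : R.A, ∃ C : ℝ, ∀ τ₁ ∈ V₁.V ζ₁, ∀ τ₂ ∈ V₂.V ζ₂,
    ‖mul (DFinsupp.single ζ₁ τ₁) (DFinsupp.single ζ₂ τ₂) ν‖ ≤ C * ‖τ₁‖ * ‖τ₂‖

/-- The pair of sectors is `γ`-regular: `Γ (τ₁ τ₂) = (Γ τ₁) (Γ τ₂)` for all `Γ ∈ G` and all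
`τ_i ∈ T_{ζ_i} ∩ V_i` with `ζ₁ + ζ₂ < γ`. -/
def SectorProduct.IsRegular {R : RegularityStructure.{u}} {α₁ α₂ : ℝ} {V₁ : Sector R α₁}
    {V₂ : Sector R α₂} (P : SectorProduct V₁ V₂) (γ : ℝ) : Prop :=
  ∀ Γ ∈ R.G, ∀ ζ₁ ζ₂ : R.A, (ζ₁ : ℝ) + ζ₂ < γ → ∀ τ₁ ∈ V₁.V ζ₁, ∀ τ₂ ∈ V₂.V ζ₂,
    Γ (P.mul (DFinsupp.single ζ₁ τ₁) (DFinsupp.single ζ₂ τ₂)) =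
      P.mul (Γ (DFinsupp.single ζ₁ τ₁)) (Γ (DFinsupp.single ζ₂ τ₂))

/-- Space-time points `z = (t, x)`. -/
abbrev SpaceTime (d : ℕ) : Type := ℝ × (Fin d → ℝ)

/-- The parabolic distance to the origin, `|z| = max (|t|^{1/2}, |x_1|, …, |x_d|)`. -/
def parNorm {d : ℕ} (z : SpaceTime d) : ℝ := max (Real.sqrt |z.1|) ‖z.2‖

/-- The unit vectors of space-time: `none` is the time direction. -/
def dirVec {d : ℕ} : Option (Fin d) → SpaceTime d
  | none => (1, 0)
  | some i => (0, Pi.single i 1)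

/-- The parabolic weight of a direction: two for time, one for space. -/
def dirWeight {d : ℕ} : Option (Fin d) → ℕ
  | none => 2
  | some _ => 1

/-- The test functions of size one: smooth functions supported in the parabolic unit ball, with all
partial derivatives of parabolic order `< r` bounded by one. A partial derivative of order `n` is
given by the list `k` of the directions of differentiation. -/
def IsUnitTest {d : ℕ} (r : ℕ) (φ : SpaceTime d → ℝ) : Prop :=
  ContDiff ℝ (⊤ : ℕ∞) φ ∧ (∀ z, φ z ≠ 0 → parNorm z ≤ 1) ∧
    ∀ (n : ℕ) (k : Fin n → Option (Fin d)), ∑ j, dirWeight (k j) < r →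
      ∀ z, |iteratedFDeriv ℝ n φ z fun j => dirVec (k j)| ≤ 1

/-- The recentred and rescaled function
`φ_z^λ(y) = λ^{-(d+2)} φ((y_0 - z_0) / λ², (y_1 - z_1) / λ, …, (y_d - z_d) / λ)`. -/
def rescale {d : ℕ} (φ : SpaceTime d → ℝ) (l : ℝ) (z y : SpaceTime d) : ℝ :=
  (l ^ (d + 2))⁻¹ * φ ((l ^ 2)⁻¹ * (y.1 - z.1), l⁻¹ • (y.2 - z.2))

section GammaSize

variable {d : ℕ} {R : RegularityStructure.{u}}

/-- `sup |Γ_{z,z'} τ|_ν / (|τ| |z - z'|^{ζ-ν})`, over `z, z' ∈ K` with `|z - z'| ≤ 1`, over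
`ν ≤ ζ < γ` and over `τ ∈ T_ζ`. -/
def gammaSize (Γ : SpaceTime d → SpaceTime d → R.Space →ₗ[ℝ] R.Space) (γ : ℝ)
    (K : Set (SpaceTime d)) : ℝ≥0∞ :=
  ⨆ (z ∈ K) (z' ∈ K) (_ : parNorm (z - z') ≤ 1) (ζ : R.A) (ν : R.A) (_ : (ζ : ℝ) < γ) (_ : ν ≤ ζ)
    (τ : R.Level ζ), ENNReal.ofReal
      (‖Γ z z' (DFinsupp.single ζ τ) ν‖ / (‖τ‖ * parNorm (z - z') ^ ((ζ : ℝ) - ν)))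

end GammaSize

/-- A model `(Π, Γ)` on space-time: `Π_z` maps `T` linearly to distributions, `Γ_{z,z'}` is an element
of the structure group, with the algebraic relations `Γ_{x,y} Γ_{y,z} = Γ_{x,z}` and
`Π_z Γ_{z,z'} = Π_{z'}` and with the analytic bounds, locally uniformly and up to each level. -/
structure Model (d r : ℕ) (R : RegularityStructure.{u}) where
  Pi : SpaceTime d → R.Space →ₗ[ℝ] 𝓓'((⊤ : TopologicalSpace.Opens (SpaceTime d)), ℝ)
  Γ : SpaceTime d → SpaceTime d → R.Space ≃ₗ[ℝ] R.Space
  mem_G : ∀ z z', Γ z z' ∈ R.G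
  cocycle : ∀ x y z τ, Γ x y (Γ y z τ) = Γ x z τ
  Pi_Γ : ∀ z z' τ, Pi z (Γ z z' τ) = Pi z' τ
  Pi_bound : ∀ (γ : ℝ) (K : Set (SpaceTime d)), Bornology.IsBounded K → ∃ C : ℝ,
    ∀ z ∈ K, ∀ l : ℝ, 0 < l → l ≤ 1 → ∀ ζ : R.A, (ζ : ℝ) < γ → ∀ τ : R.Level ζ,
      ∀ φ : SpaceTime d → ℝ, IsUnitTest r φ →
        ∀ ψ : 𝓓((⊤ : TopologicalSpace.Opens (SpaceTime d)), ℝ), (∀ y, ψ y = rescale φ l z y) →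
          |Pi z (DFinsupp.single ζ τ) ψ| ≤ C * ‖τ‖ * l ^ (ζ : ℝ)
  Γ_bound : ∀ (γ : ℝ) (K : Set (SpaceTime d)), Bornology.IsBounded K →
    gammaSize (fun z z' => (Γ z z' : R.Space →ₗ[ℝ] R.Space)) γ K < ∞

/-- Lebesgue measure on `(a, b) × 𝕋^d`, the torus being represented by the cell `[0, 1)^d`. -/
def torusSlab (d : ℕ) (a b : ℝ) : Measure (SpaceTime d) :=
  volume.restrict (Ioo a b ×ˢ univ.pi fun _ => Ico (0 : ℝ) 1)

/-- The points `(0, T) × [-1, 2]^d`: the cell `(0, T) × [0, 1)^d` and all points of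
`(0, T) × ℝ^d` at distance at most one from it. -/
def cellNhd (d : ℕ) (T : ℝ) : Set (SpaceTime d) :=
  Ioo 0 T ×ˢ univ.pi fun _ => Icc (-1 : ℝ) 2

namespace Model

variable {d r : ℕ} {R : RegularityStructure.{u}}

/-- `‖Γ‖`, up to level `γ`, on `(0, T) × 𝕋^d`. -/
def normΓ (M : Model d r R) (γ T : ℝ) : ℝ≥0∞ :=
  gammaSize (fun z z' => (M.Γ z z' : R.Space →ₗ[ℝ] R.Space)) γ (cellNhd d T)

/-- `‖Γ - Γ'‖` for two models, up to level `γ`, on `(0, T) × 𝕋^d`. -/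
def distΓ (M M' : Model d r R) (γ T : ℝ) : ℝ≥0∞ :=
  gammaSize
    (fun z z' => (M.Γ z z' : R.Space →ₗ[ℝ] R.Space) - (M'.Γ z z' : R.Space →ₗ[ℝ] R.Space))
    γ (cellNhd d T)

end Model

section ModelledDistributions

variable {d r : ℕ} {R : RegularityStructure.{u}}

/-- The local distance
`‖f - g‖ = sup_{ζ < γ} ‖ |f(z) - g(z)|_ζ t^{-(η-ζ)/2} ‖_{L^p((0,T) × 𝕋^d)}`. -/
def localDist (γ η T : ℝ) (p : ℝ≥0∞) (f g : SpaceTime d → R.Space) : ℝ≥0∞ :=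
  ⨆ (ζ : R.A) (_ : (ζ : ℝ) < γ),
    eLpNorm (fun z => ‖(f z - g z) ζ‖ / z.1 ^ ((η - ζ) / 2)) p (torusSlab d 0 T)

/-- The translation part of the norm of `D^{γ,η,T}_p`. -/
def translNorm (M : Model d r R) (γ η T : ℝ) (p : ℝ≥0∞) (f : SpaceTime d → R.Space) : ℝ≥0∞ :=
  ⨆ (ζ : R.A) (_ : (ζ : ℝ) < γ) (h : SpaceTime d) (_ : parNorm h < 1),
    eLpNorm (fun z => ‖(f (z + h) - M.Γ (z + h) z (f z)) ζ‖ /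
        (parNorm h ^ (γ - ζ) * z.1 ^ ((η - γ) / 2))) p
      (torusSlab d (3 * parNorm h ^ 2) (T - parNorm h ^ 2))

/-- The translation part of the distance between elements of the spaces `D^{γ,η,T}_p` of two
models. -/
def translDist (M M' : Model d r R) (γ η T : ℝ) (p : ℝ≥0∞) (f g : SpaceTime d → R.Space) : ℝ≥0∞ :=
  ⨆ (ζ : R.A) (_ : (ζ : ℝ) < γ) (h : SpaceTime d) (_ : parNorm h < 1),
    eLpNorm (fun z =>
        ‖(f (z + h) - g (z + h) - M.Γ (z + h) z (f z) + M'.Γ (z + h) z (g z)) ζ‖ /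
        (parNorm h ^ (γ - ζ) * z.1 ^ ((η - γ) / 2))) p
      (torusSlab d (3 * parNorm h ^ 2) (T - parNorm h ^ 2))

/-- The norm `|||f|||` of `D^{γ,η,T}_p`: the local part plus the translation part. -/
def dNorm (M : Model d r R) (γ η T : ℝ) (p : ℝ≥0∞) (f : SpaceTime d → R.Space) : ℝ≥0∞ :=
  localDist γ η T p f 0 + translNorm M γ η T p f

/-- The distance `|||f; g|||` between elements of the spaces `D^{γ,η,T}_p` of two models. -/
def dDist (M M' : Model d r R) (γ η T : ℝ) (p : ℝ≥0∞) (f g : SpaceTime d → R.Space) : ℝ≥0∞ :=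
  localDist γ η T p f g + translDist M M' γ η T p f g

/-- `f ∈ D^{γ,η,T}_p`: on `(0, T) × ℝ^d`, the map `f` is measurable, periodic in space and takes
values in `T_{<γ}`, and its norm is finite. Since only finitely many levels are below `γ`, the norm
is finite as soon as each of its terms is. The values of `f` at times outside `(0, T)` are
irrelevant. -/
structure MemD (M : Model d r R) (γ η T : ℝ) (p : ℝ≥0∞) (f : SpaceTime d → R.Space) : Prop where
  measurable : ∀ ζ : R.A,
    AEStronglyMeasurable (fun z => f z ζ) (volume.restrict (Ioo 0 T ×ˢ univ))
  periodic : ∀ t ∈ Ioo 0 T, ∀ (x : Fin d → ℝ) (k : Fin d → ℤ),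
    f (t, x + fun i => (k i : ℝ)) = f (t, x)
  level_lt : ∀ t ∈ Ioo 0 T, ∀ (x : Fin d → ℝ) (ζ : R.A), γ ≤ ζ → f (t, x) ζ = 0
  norm_lt_top : dNorm M γ η T p f < ∞

/-- `f ∈ D^{γ,η,T}_p(V)`: moreover, `f` takes values in the sector `V`. -/
def MemDSector (M : Model d r R) {α : ℝ} (V : Sector R α) (γ η T : ℝ) (p : ℝ≥0∞)
    (f : SpaceTime d → R.Space) : Prop :=
  MemD M γ η T p f ∧ ∀ t ∈ Ioo 0 T, ∀ (x : Fin d → ℝ) (ζ : R.A), f (t, x) ζ ∈ V.V ζ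

/-- The product of two maps with values in sectors, projected to `T_{<γ}`. -/
def SectorProduct.mulFun {α₁ α₂ : ℝ} {V₁ : Sector R α₁} {V₂ : Sector R α₂}
    (P : SectorProduct V₁ V₂) (γ : ℝ) (f₁ f₂ : SpaceTime d → R.Space) : SpaceTime d → R.Space :=
  fun z => R.trunc γ (P.mul (f₁ z) (f₂ z))

end ModelledDistributions

end

noncomputable section

open RegularityStructure

/-! ### Components and triangularity in the graded space. -/

namespace RegularityStructure

variable (R : RegularityStructure.{u})

/-! The estimate is a discrete Leibniz rule combined with Hölder's inequality. Write `F`, `G` for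
values at `z + h` and `f`, `g` for values at `z`. If `Γ` were fully multiplicative, the increment of
the product would telescope exactly into four products, each with one factor that is an increment of
a single `f_i` or `g_i`, a difference of two such increments, or the value `F₂` or `F₂ - G₂` at the
shifted point. Multiplicativity holds only for pairs of levels whose sum is below `γ`. The pairs
with sum at least `γ`, which the projection removes, leave a finite correction, which telescopes
into four more products per pair. This identity is `SectorProduct.IsRegular.mul_increment_apply`.

All sizes are measured with the weights `|h|^{s-ζ} t^{(η-s)/2}` of `parWeight`: `s = γ` gives the
translation norm and `s = ζ` the local norm. These weights multiply (`parWeight_mul`), and they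
decrease in `s` as long as `|h|² ≤ t` (`parWeight_antitone`), which holds on the domain `t > 3|h|²`.
A product is therefore controlled as soon as its exponents satisfy `s₁ + s₂ ≥ γ`. For an increment
of the first factor, `s₁ = γ₁` and `s₂ = ζ₂ ≥ α₂`; for an increment of the second, `s₂ = γ₂` and `s₁
= ζ₁ ≥ α₁`. This is why `γ` is the minimum of `γ₁ + α₂` and `γ₂ + α₁`. For the removed pairs, `s_i`
are the two levels themselves, and their sum is at least `γ` by definition.

The factors `Γ f` are handled by `IsTransport.weightedNorm_le`. The values at `z + h` are brought
back to `z` by translation invariance on the torus and by comparability of `t + h₀` with `t`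
(`weightedNorm_shift_le`). Hölder's inequality is `SectorProduct.exists_weightedNorm_mul_le`. Only
finitely many levels occur, so constants depend on levels and exponents, but not on `T` or the
models. Since `p` may be less than one, triangle inequalities carry constants and need
measurability; for `Γ_{z+h,z} f(z)` this comes from the continuity of `Γ` in both points. Membership
of the product is the case of equal models and `g₁ = g₂ = 0`. -/

theorem finite_levels (a c : ℝ) : {ζ : R.A | a ≤ ζ ∧ (ζ : ℝ) < c}.Finite := by
  refine Finite.of_finite_image (f := Subtype.val) ?_ Subtype.val_injective.injOn
  refine (R.locallyFinite a c).subset ?_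
  rintro _ ⟨ζ, h, rfl⟩
  exact ⟨ζ.2, h.1, h.2.le⟩

/-- The finitely many homogeneities in `[a, c)`. -/
def levels (a c : ℝ) : Finset R.A := (R.finite_levels a c).toFinset

variable {R}

@[simp] theorem mem_levels {a c : ℝ} {ζ : R.A} : ζ ∈ R.levels a c ↔ a ≤ ζ ∧ (ζ : ℝ) < c := by
  simp [levels]

theorem trunc_apply (γ : ℝ) (τ : R.Space) (ζ : R.A) :
    R.trunc γ τ ζ = if (ζ : ℝ) < γ then τ ζ else 0 := by
  simp [trunc, DFinsupp.filter_apply]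

theorem eq_sum_single {S : Finset R.A} {u : R.Space} (h : ∀ ζ, ζ ∉ S → u ζ = 0) :
    u = ∑ ζ ∈ S, DFinsupp.single ζ (u ζ) := by
  ext ν
  rw [DFinsupp.finsetSum_apply]
  by_cases hν : ν ∈ S
  · rw [Finset.sum_eq_single ν]
    · simp
    · intro b _ hb
      exact DFinsupp.single_eq_of_ne hb.symm
    · exact fun h => absurd hν h
  · rw [h ν hν, Finset.sum_eq_zero]
    intro b hb
    exact DFinsupp.single_eq_of_ne (fun hbν => hν (hbν ▸ hb))

theorem apply_eq_sum {S : Finset R.A} {u : R.Space} (h : ∀ ζ, ζ ∉ S → u ζ = 0)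
    (L : R.Space →ₗ[ℝ] R.Space) : L u = ∑ ζ ∈ S, L (DFinsupp.single ζ (u ζ)) := by
  conv_lhs => rw [eq_sum_single h, map_sum]

theorem apply_single_eq_zero {Γ : R.Space ≃ₗ[ℝ] R.Space} (hΓ : Γ ∈ R.G) {ζ ν : R.A} (h : ζ < ν)
    (τ : R.Level ζ) : Γ (DFinsupp.single ζ τ) ν = 0 := by
  have := R.triangular Γ hΓ ζ τ ν h.le
  rwa [DFinsupp.sub_apply, DFinsupp.single_eq_of_ne h.ne', sub_zero] at this

theorem apply_single_same {Γ : R.Space ≃ₗ[ℝ] R.Space} (hΓ : Γ ∈ R.G) (ζ : R.A)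
    (τ : R.Level ζ) : Γ (DFinsupp.single ζ τ) ζ = τ := by
  have := R.triangular Γ hΓ ζ τ ζ le_rfl
  rwa [DFinsupp.sub_apply, DFinsupp.single_eq_same, sub_eq_zero] at this

end RegularityStructure

/-! ### Truncated sectors and their invariance under the structure group. -/

namespace Sector

variable {R : RegularityStructure.{u}} {α : ℝ}

/-- The elements of the sector without components of homogeneity `≥ γ`. -/
def below (V : Sector R α) (γ : ℝ) : Submodule ℝ R.Space where
  carrier := {u | ∀ ζ : R.A, u ζ ∈ V.V ζ ∧ (γ ≤ ζ → u ζ = 0)}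
  add_mem' hu hv ζ := ⟨by simpa using (V.V ζ).add_mem (hu ζ).1 (hv ζ).1, fun h => by
    simp [(hu ζ).2 h, (hv ζ).2 h]⟩
  zero_mem' ζ := ⟨by simp, fun _ => rfl⟩
  smul_mem' c u hu ζ := ⟨by simpa using (V.V ζ).smul_mem c (hu ζ).1, fun h => by
    simp [(hu ζ).2 h]⟩

variable {V : Sector R α} {γ : ℝ}

theorem mem_below {u : R.Space} :
    u ∈ V.below γ ↔ ∀ ζ : R.A, u ζ ∈ V.V ζ ∧ (γ ≤ ζ → u ζ = 0) := Iff.rfl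

theorem eq_zero_of_notMem_levels {u : R.Space} (hu : u ∈ V.below γ) (ζ : R.A)
    (hζ : ζ ∉ R.levels α γ) : u ζ = 0 := by
  by_cases h : γ ≤ ζ
  · exact (hu ζ).2 h
  · have h' : (ζ : ℝ) < α := by
      by_contra h''
      exact hζ (mem_levels.2 ⟨not_lt.1 h'', not_le.1 h⟩)
    have := (hu ζ).1
    rwa [V.eq_bot ζ h', Submodule.mem_bot] at this

theorem single_mem_below {ζ : R.A} {τ : R.Level ζ} (hτ : τ ∈ V.V ζ) (hζ : (ζ : ℝ) < γ) :
    (DFinsupp.single ζ τ : R.Space) ∈ V.below γ := by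
  intro ν
  by_cases h : ν = ζ
  · subst h
    simpa using ⟨hτ, fun h => absurd hζ (not_lt.2 h)⟩
  · rw [DFinsupp.single_eq_of_ne h]
    exact ⟨zero_mem _, fun _ => rfl⟩

theorem apply_mem_below {Γ : R.Space ≃ₗ[ℝ] R.Space} (hΓ : Γ ∈ R.G) {u : R.Space}
    (hu : u ∈ V.below γ) : Γ u ∈ V.below γ := by
  have h := apply_eq_sum (eq_zero_of_notMem_levels hu) (Γ : R.Space →ₗ[ℝ] R.Space)
  rw [LinearEquiv.coe_coe] at h
  rw [h]
  refine Submodule.sum_mem _ fun ζ hζ ν => ⟨V.invariant Γ hΓ ζ _ (hu ζ).1 ν, fun hν => ?_⟩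
  refine apply_single_eq_zero hΓ ?_ _
  have := (mem_levels.1 hζ).2
  exact Subtype.coe_lt_coe.1 (this.trans_le hν)

end Sector

/-! ### Algebra of truncated products. -/

namespace SectorProduct

variable {R : RegularityStructure.{u}} {α₁ α₂ : ℝ} {V₁ : Sector R α₁} {V₂ : Sector R α₂}
  (P : SectorProduct V₁ V₂) {γ₁ γ₂ : ℝ}

theorem mul_eq_sum {u v : R.Space} (hu : u ∈ V₁.below γ₁) (hv : v ∈ V₂.below γ₂) :
    P.mul u v = ∑ q ∈ R.levels α₁ γ₁ ×ˢ R.levels α₂ γ₂,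
      P.mul (DFinsupp.single q.1 (u q.1)) (DFinsupp.single q.2 (v q.2)) := by
  conv_lhs => rw [eq_sum_single (Sector.eq_zero_of_notMem_levels hu), map_sum,
    LinearMap.sum_apply]
  rw [Finset.sum_product]
  refine Finset.sum_congr rfl fun ζ _ => ?_
  exact apply_eq_sum (Sector.eq_zero_of_notMem_levels hv) _

theorem mul_apply_eq_sum {u v : R.Space} (hu : u ∈ V₁.below γ₁) (hv : v ∈ V₂.below γ₂) (ν : R.A) :
    P.mul u v ν = ∑ q ∈ R.levels α₁ γ₁ ×ˢ R.levels α₂ γ₂ with (q.1 : ℝ) + q.2 = ν,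
      P.mul (DFinsupp.single q.1 (u q.1)) (DFinsupp.single q.2 (v q.2)) ν := by
  rw [P.mul_eq_sum hu hv, DFinsupp.finsetSum_apply, Finset.sum_filter]
  refine Finset.sum_congr rfl fun q _ => ?_
  split_ifs with h
  · rfl
  · exact P.homogeneous _ _ _ (hu _).1 _ (hv _).1 _ (Ne.symm h)

theorem exists_norm_mul_le (γ₁ γ₂ : ℝ) : ∃ K : ℝ≥0, ∀ q ∈ R.levels α₁ γ₁ ×ˢ R.levels α₂ γ₂,
    ∀ ν : R.A, (q.1 : ℝ) + q.2 = ν → ∀ τ₁ ∈ V₁.V q.1, ∀ τ₂ ∈ V₂.V q.2,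
      ‖P.mul (DFinsupp.single q.1 τ₁) (DFinsupp.single q.2 τ₂) ν‖ ≤ K * ‖τ₁‖ * ‖τ₂‖ := by
  classical
  choose C hC using P.continuous
  -- The target level is determined by the pair, so a finite sum over pairs bounds all continuity
  -- constants. The value `0` is never used, as a pair whose sum is not a homogeneity has no target
  -- level.
  let N : R.A × R.A → ℝ≥0 := fun q =>
    if h : (q.1 : ℝ) + q.2 ∈ R.A then (C q.1 q.2 ⟨_, h⟩).toNNReal else 0
  refine ⟨∑ q ∈ R.levels α₁ γ₁ ×ˢ R.levels α₂ γ₂, N q, ?_⟩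
  rintro q hq ν hν τ₁ h₁ τ₂ h₂
  have hN : N q ≤ ∑ q ∈ R.levels α₁ γ₁ ×ˢ R.levels α₂ γ₂, N q :=
    Finset.single_le_sum (f := N) (fun _ _ => zero_le) hq
  have hmem : (q.1 : ℝ) + q.2 ∈ R.A := hν ▸ ν.2
  have hN' : N q = (C q.1 q.2 ν).toNNReal := by
    have : (⟨(q.1 : ℝ) + q.2, hmem⟩ : R.A) = ν := Subtype.ext hν
    simp only [N, dif_pos hmem, this]
  have hCN : C q.1 q.2 ν ≤ ((∑ q ∈ R.levels α₁ γ₁ ×ˢ R.levels α₂ γ₂, N q : ℝ≥0) : ℝ) :=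
    (Real.le_coe_toNNReal _).trans (by rw [← hN']; exact_mod_cast hN)
  refine (hC _ _ _ _ h₁ _ h₂).trans ?_
  gcongr

/-- The pairs of homogeneities whose sum is not below `γ`. -/
def highPairs (_ : SectorProduct V₁ V₂) (γ₁ γ₂ γ : ℝ) : Finset (R.A × R.A) :=
  {q ∈ R.levels α₁ γ₁ ×ˢ R.levels α₂ γ₂ | ¬ (q.1 : ℝ) + q.2 < γ}

variable {P} {γ : ℝ}

theorem mem_highPairs {q : R.A × R.A} : q ∈ P.highPairs γ₁ γ₂ γ ↔
    (q.1 ∈ R.levels α₁ γ₁ ∧ q.2 ∈ R.levels α₂ γ₂) ∧ γ ≤ (q.1 : ℝ) + q.2 := by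
  simp only [highPairs, Finset.mem_filter, Finset.mem_product, not_lt]

theorem trunc_mul_eq_sum {u v : R.Space} (hu : u ∈ V₁.below γ₁) (hv : v ∈ V₂.below γ₂) :
    R.trunc γ (P.mul u v) =
      ∑ q ∈ R.levels α₁ γ₁ ×ˢ R.levels α₂ γ₂ with (q.1 : ℝ) + q.2 < γ,
        P.mul (DFinsupp.single q.1 (u q.1)) (DFinsupp.single q.2 (v q.2)) := by
  ext ν
  rw [trunc_apply, P.mul_eq_sum hu hv, DFinsupp.finsetSum_apply, DFinsupp.finsetSum_apply,
    Finset.sum_filter]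
  have hom := fun (q : R.A × R.A) => P.homogeneous q.1 q.2 _ (hu q.1).1 _ (hv q.2).1 ν
  split_ifs with h
  · refine Finset.sum_congr rfl fun q _ => ?_
    split_ifs with h'
    · rfl
    · exact hom q fun e => h' (e ▸ h)
  · refine (Finset.sum_eq_zero fun q _ => ?_).symm
    split_ifs with h'
    · exact hom q fun e => h (e ▸ h')
    · rfl

/-- The structure group acts on truncated products up to the terms of high homogeneity. -/
theorem IsRegular.apply_trunc_mul (hP : P.IsRegular γ) {Γ : R.Space ≃ₗ[ℝ] R.Space} (hΓ : Γ ∈ R.G)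
    {u v : R.Space} (hu : u ∈ V₁.below γ₁) (hv : v ∈ V₂.below γ₂) :
    Γ (R.trunc γ (P.mul u v)) = P.mul (Γ u) (Γ v) - ∑ q ∈ P.highPairs γ₁ γ₂ γ,
      P.mul (Γ (DFinsupp.single q.1 (u q.1))) (Γ (DFinsupp.single q.2 (v q.2))) := by
  have h : P.mul (Γ u) (Γ v) = ∑ q ∈ R.levels α₁ γ₁ ×ˢ R.levels α₂ γ₂,
      P.mul (Γ (DFinsupp.single q.1 (u q.1))) (Γ (DFinsupp.single q.2 (v q.2))) := by
    have h₁ := apply_eq_sum (Sector.eq_zero_of_notMem_levels hu) (Γ : R.Space →ₗ[ℝ] R.Space)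
    have h₂ := apply_eq_sum (Sector.eq_zero_of_notMem_levels hv) (Γ : R.Space →ₗ[ℝ] R.Space)
    rw [LinearEquiv.coe_coe] at h₁ h₂
    rw [h₁, map_sum P.mul, LinearMap.sum_apply, Finset.sum_product, h₂]
    exact Finset.sum_congr rfl fun _ _ => map_sum _ _ _
  -- Once the high pairs are moved to the left, only pairs with sum below `γ` remain to be compared,
  -- and there regularity applies term by term.
  rw [trunc_mul_eq_sum hu hv, h, highPairs, eq_sub_iff_add_eq, map_sum,
    ← Finset.sum_filter_add_sum_filter_not (R.levels α₁ γ₁ ×ˢ R.levels α₂ γ₂)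
      (fun q : R.A × R.A => (q.1 : ℝ) + q.2 < γ)]
  congr 1
  refine Finset.sum_congr rfl fun q hq => ?_
  exact hP Γ hΓ _ _ (Finset.mem_filter.1 hq).2 _ (hu _).1 _ (hv _).1

/-- The increment of a product, in terms of the increments of the factors. Here `F` and `G` are the
values at the endpoint, `f` and `g` those at the base point. -/
theorem IsRegular.mul_increment_apply (hP : P.IsRegular γ) {Γ Γ' : R.Space ≃ₗ[ℝ] R.Space}
    (hΓ : Γ ∈ R.G) (hΓ' : Γ' ∈ R.G) {F₁ F₂ G₁ G₂ f₁ f₂ g₁ g₂ : R.Space}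
    (hf₁ : f₁ ∈ V₁.below γ₁) (hf₂ : f₂ ∈ V₂.below γ₂)
    (hg₁ : g₁ ∈ V₁.below γ₁) (hg₂ : g₂ ∈ V₂.below γ₂) {ν : R.A} (hν : (ν : ℝ) < γ) :
    (R.trunc γ (P.mul F₁ F₂) - R.trunc γ (P.mul G₁ G₂) - Γ (R.trunc γ (P.mul f₁ f₂))
        + Γ' (R.trunc γ (P.mul g₁ g₂))) ν =
      P.mul (F₁ - G₁ - Γ f₁ + Γ' g₁) F₂ ν + P.mul (G₁ - Γ' g₁) (F₂ - G₂) ν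
      + P.mul (Γ f₁) (F₂ - G₂ - Γ f₂ + Γ' g₂) ν
      + P.mul (((Γ : R.Space →ₗ[ℝ] R.Space) - Γ') f₁ + Γ' (f₁ - g₁)) (G₂ - Γ' g₂) ν
      + ∑ q ∈ P.highPairs γ₁ γ₂ γ,
        (P.mul (Γ (DFinsupp.single q.1 ((f₁ - g₁) q.1))) (Γ (DFinsupp.single q.2 (f₂ q.2))) ν
        + P.mul (((Γ : R.Space →ₗ[ℝ] R.Space) - Γ') (DFinsupp.single q.1 (g₁ q.1)))
            (Γ (DFinsupp.single q.2 (f₂ q.2))) ν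
        + P.mul (Γ' (DFinsupp.single q.1 (g₁ q.1)))
            (((Γ : R.Space →ₗ[ℝ] R.Space) - Γ') (DFinsupp.single q.2 (f₂ q.2))) ν
        + P.mul (Γ' (DFinsupp.single q.1 (g₁ q.1)))
            (Γ' (DFinsupp.single q.2 ((f₂ - g₂) q.2))) ν) := by
  rw [hP.apply_trunc_mul hΓ hf₁ hf₂, hP.apply_trunc_mul hΓ' hg₁ hg₂]
  -- For each pair, the passage from `(Γ f₁)(Γ f₂)` to `(Γ' g₁)(Γ' g₂)` changes one ingredient at a
  -- time: `f₁`, the first `Γ`, the second `Γ`, then `f₂`.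
  have hsum : ∑ q ∈ P.highPairs γ₁ γ₂ γ,
        (P.mul (Γ (DFinsupp.single q.1 ((f₁ - g₁) q.1))) (Γ (DFinsupp.single q.2 (f₂ q.2))) ν
        + P.mul (((Γ : R.Space →ₗ[ℝ] R.Space) - Γ') (DFinsupp.single q.1 (g₁ q.1)))
            (Γ (DFinsupp.single q.2 (f₂ q.2))) ν
        + P.mul (Γ' (DFinsupp.single q.1 (g₁ q.1)))
            (((Γ : R.Space →ₗ[ℝ] R.Space) - Γ') (DFinsupp.single q.2 (f₂ q.2))) ν
        + P.mul (Γ' (DFinsupp.single q.1 (g₁ q.1)))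
            (Γ' (DFinsupp.single q.2 ((f₂ - g₂) q.2))) ν) =
      (∑ q ∈ P.highPairs γ₁ γ₂ γ,
        P.mul (Γ (DFinsupp.single q.1 (f₁ q.1))) (Γ (DFinsupp.single q.2 (f₂ q.2)))) ν
      - (∑ q ∈ P.highPairs γ₁ γ₂ γ,
        P.mul (Γ' (DFinsupp.single q.1 (g₁ q.1))) (Γ' (DFinsupp.single q.2 (g₂ q.2)))) ν := by
    rw [DFinsupp.finsetSum_apply, DFinsupp.finsetSum_apply, ← Finset.sum_sub_distrib]
    refine Finset.sum_congr rfl fun q _ => ?_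
    simp only [DFinsupp.sub_apply, DFinsupp.single_sub, map_sub, LinearMap.sub_apply,
      LinearEquiv.coe_coe]
    abel
  rw [hsum]
  simp only [DFinsupp.sub_apply, DFinsupp.add_apply, trunc_apply, if_pos hν, map_sub, map_add,
    LinearMap.sub_apply, LinearMap.add_apply, LinearEquiv.coe_coe]
  abel

end SectorProduct

/-! ### Weighted `L^p` norms, including `p < 1`. -/

section Lp

variable {X : Type*} [MeasurableSpace X] {μ : Measure X}

/-- The constant of the triangle inequality for `n` functions in `L^p`, where `p < 1` is allowed. -/
def lpSumConst (p : ℝ≥0∞) (n : ℕ) : ℝ≥0∞ := max 1 p.LpAddConst ^ n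

theorem lpSumConst_ne_top (p : ℝ≥0∞) (n : ℕ) : lpSumConst p n ≠ ∞ :=
  ENNReal.pow_ne_top (max_lt ENNReal.one_lt_top (ENNReal.LpAddConst_lt_top p)).ne

theorem lpSumConst_mono (p : ℝ≥0∞) {m n : ℕ} (h : m ≤ n) : lpSumConst p m ≤ lpSumConst p n :=
  pow_le_pow_right₀ (le_max_left _ _) h

theorem eLpNorm_sum_le_lpSumConst {ι : Type*} (s : Finset ι) {f : ι → X → ℝ} (p : ℝ≥0∞)
    (hf : ∀ i ∈ s, AEStronglyMeasurable (f i) μ) :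
    eLpNorm (fun x => ∑ i ∈ s, f i x) p μ ≤ lpSumConst p s.card * ∑ i ∈ s, eLpNorm (f i) p μ := by
  classical
  induction s using Finset.induction_on with
  | empty => simp
  | insert i s hi ih =>
    have hs := ih fun j hj => hf j (Finset.mem_insert_of_mem hj)
    have hm : AEStronglyMeasurable (fun x => ∑ j ∈ s, f j x) μ :=
      Finset.aestronglyMeasurable_fun_sum s fun j hj => hf j (Finset.mem_insert_of_mem hj)
    have hadd := eLpNorm_add_le' (hf i (Finset.mem_insert_self i s)) hm p
    have heq : (fun x => ∑ j ∈ insert i s, f j x) = f i + fun x => ∑ j ∈ s, f j x := by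
      ext x; simp [Finset.sum_insert hi]
    rw [heq, Finset.sum_insert hi, Finset.card_insert_of_notMem hi]
    calc _ ≤ _ := hadd
      _ ≤ max 1 p.LpAddConst * (lpSumConst p s.card * eLpNorm (f i) p μ +
          lpSumConst p s.card * ∑ j ∈ s, eLpNorm (f j) p μ) := by
        gcongr
        · exact le_max_right _ _
        · exact le_mul_of_one_le_left zero_le (one_le_pow₀ (le_max_left _ _))
      _ = _ := by rw [← mul_add, ← mul_assoc, lpSumConst, lpSumConst, pow_succ']

/-- The norm in `L^p` of `|F| / w`. -/
def weightedNorm {E : Type*} [NormedAddCommGroup E] (μ : Measure X) (p : ℝ≥0∞) (w : X → ℝ)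
    (F : X → E) : ℝ≥0∞ := eLpNorm (fun x => ‖F x‖ / w x) p μ

variable {E : Type*} [NormedAddCommGroup E] {p : ℝ≥0∞}

theorem weightedNorm_le_mul {E' : Type*} [NormedAddCommGroup E'] {w w' : X → ℝ} {F : X → E}
    {G : X → E'} (c : ℝ≥0)
    (h : ∀ᵐ x ∂μ, 0 ≤ w x ∧ 0 ≤ w' x ∧ ‖F x‖ / w x ≤ c * (‖G x‖ / w' x)) :
    weightedNorm μ p w F ≤ c * weightedNorm μ p w' G := by
  refine eLpNorm_le_nnreal_smul_eLpNorm_of_ae_le_mul ?_ p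
  filter_upwards [h] with x ⟨h₀, h₁, h₂⟩
  rw [← NNReal.coe_le_coe]
  push_cast
  rwa [Real.norm_of_nonneg (by positivity), Real.norm_of_nonneg (by positivity)]

theorem weightedNorm_congr {w w' : X → ℝ} {F G : X → E} (hw : ∀ᵐ x ∂μ, w x = w' x)
    (h : ∀ᵐ x ∂μ, F x = G x) :
    weightedNorm μ p w F = weightedNorm μ p w' G := by
  refine eLpNorm_congr_ae ?_
  filter_upwards [h, hw] with x hx hx'
  rw [hx, hx']

theorem weightedNorm_sum_le {ι : Type*} (s : Finset ι) {F : ι → X → E} {w : X → ℝ}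
    (hF : ∀ i ∈ s, AEStronglyMeasurable (F i) μ) (hw : AEMeasurable w μ) (hw₀ : ∀ᵐ x ∂μ, 0 ≤ w x) :
    weightedNorm μ p w (fun x => ∑ i ∈ s, F i x) ≤
      lpSumConst p s.card * ∑ i ∈ s, weightedNorm μ p w (F i) := by
  refine le_trans (eLpNorm_mono_ae_real (g := fun x => ∑ i ∈ s, ‖F i x‖ / w x) ?_)
    (eLpNorm_sum_le_lpSumConst s p fun i hi =>
      ((hF i hi).norm.aemeasurable.div hw).aestronglyMeasurable)
  filter_upwards [hw₀] with x hx
  rw [Real.norm_of_nonneg (by positivity), ← Finset.sum_div]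
  gcongr
  exact norm_sum_le _ _

theorem weightedNorm_add_le {F G : X → E} {w : X → ℝ} {A B : ℝ≥0∞}
    (hF : AEStronglyMeasurable F μ) (hG : AEStronglyMeasurable G μ)
    (hw : AEMeasurable w μ) (hw₀ : ∀ᵐ x ∂μ, 0 ≤ w x)
    (hA : weightedNorm μ p w F ≤ A) (hB : weightedNorm μ p w G ≤ B) :
    weightedNorm μ p w (fun x => F x + G x) ≤ lpSumConst p 2 * (A + B) := by
  have := weightedNorm_sum_le (μ := μ) (p := p) Finset.univ (F := ![F, G]) (w := w)
    (by simp [hF, hG]) hw hw₀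
  simp only [Fin.sum_univ_two, Matrix.cons_val_zero, Matrix.cons_val_one, Finset.card_univ,
    Fintype.card_fin] at this
  exact this.trans (by gcongr)

end Lp

/-! ### Measurability and Hölder's inequality for sector products. -/

namespace SectorProduct

variable {R : RegularityStructure.{u}} {α₁ α₂ : ℝ} {V₁ : Sector R α₁} {V₂ : Sector R α₂}
  (P : SectorProduct V₁ V₂) {X : Type*} [MeasurableSpace X] {μ : Measure X}

/-- The component `ν` of the product on a pair of levels. -/
def levelMul (ζ₁ ζ₂ ν : R.A) : V₁.V ζ₁ →ₗ[ℝ] V₂.V ζ₂ →ₗ[ℝ] R.Level ν :=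
  (P.mul.compl₁₂ ((DFinsupp.lsingle ζ₁).comp (V₁.V ζ₁).subtype)
    ((DFinsupp.lsingle ζ₂).comp (V₂.V ζ₂).subtype)).compr₂ (DFinsupp.lapply ν)

theorem continuous_levelMul (ζ₁ ζ₂ ν : R.A) :
    Continuous fun τ : V₁.V ζ₁ × V₂.V ζ₂ => P.levelMul ζ₁ ζ₂ ν τ.1 τ.2 := by
  obtain ⟨C, hC⟩ := P.continuous ζ₁ ζ₂ ν
  let B := (P.levelMul ζ₁ ζ₂ ν).mkContinuous₂ C fun x y => hC x x.2 y y.2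
  exact B.continuous₂

/-- The product is continuous only on the sectors, so measurable factors must first be viewed as
maps into the subspaces `V_ζ` before composing. -/
theorem _root_.MeasureTheory.AEStronglyMeasurable.exists_codRestrict {E : Type*}
    [NormedAddCommGroup E] [NormedSpace ℝ E] {W : Submodule ℝ E} {f : X → E}
    (hf : AEStronglyMeasurable f μ) (hW : ∀ᵐ x ∂μ, f x ∈ W) :
    ∃ g : X → W, AEStronglyMeasurable g μ ∧ ∀ᵐ x ∂μ, f x = g x := by
  classical
  let g : X → W := fun x => if h : f x ∈ W then ⟨f x, h⟩ else 0
  have hg : ∀ᵐ x ∂μ, f x = g x := by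
    filter_upwards [hW] with x hx
    simp [g, hx]
  refine ⟨g, ?_, hg⟩
  exact (Topology.IsEmbedding.subtypeVal.aestronglyMeasurable_comp_iff).1 (hf.congr hg)

variable {γ₁ γ₂ : ℝ}

theorem aestronglyMeasurable_mul {u v : X → R.Space}
    (hu : ∀ ζ, AEStronglyMeasurable (fun x => u x ζ) μ) (hu' : ∀ᵐ x ∂μ, u x ∈ V₁.below γ₁)
    (hv : ∀ ζ, AEStronglyMeasurable (fun x => v x ζ) μ) (hv' : ∀ᵐ x ∂μ, v x ∈ V₂.below γ₂)
    (ν : R.A) : AEStronglyMeasurable (fun x => P.mul (u x) (v x) ν) μ := by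
  have h : ∀ᵐ x ∂μ, ∑ q ∈ R.levels α₁ γ₁ ×ˢ R.levels α₂ γ₂ with (q.1 : ℝ) + q.2 = ν,
      P.mul (DFinsupp.single q.1 (u x q.1)) (DFinsupp.single q.2 (v x q.2)) ν =
        P.mul (u x) (v x) ν := by
    filter_upwards [hu', hv'] with x h₁ h₂
    exact (P.mul_apply_eq_sum h₁ h₂ ν).symm
  refine AEStronglyMeasurable.congr (Finset.aestronglyMeasurable_fun_sum _ fun q _ => ?_) h
  obtain ⟨u', hu₁, hu₂⟩ := (hu q.1).exists_codRestrict (hu'.mono fun x hx => (hx q.1).1)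
  obtain ⟨v', hv₁, hv₂⟩ := (hv q.2).exists_codRestrict (hv'.mono fun x hx => (hx q.2).1)
  refine ((P.continuous_levelMul q.1 q.2 ν).comp_aestronglyMeasurable (hu₁.prodMk hv₁)).congr ?_
  filter_upwards [hu₂, hv₂] with x h₁ h₂
  rw [h₁, h₂]
  rfl

/-- Hölder's inequality for the product of a pair of sectors, with weights. -/
theorem exists_weightedNorm_mul_le (γ₁ γ₂ : ℝ) (p₁ p₂ p : ℝ≥0∞) [ENNReal.HolderTriple p₁ p₂ p] :
    ∃ C : ℝ≥0, ∀ {X : Type} [MeasurableSpace X] (μ : Measure X) (u v : X → R.Space)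
      (w₁ w₂ : R.A → X → ℝ) (w : X → ℝ) (ν : R.A) (A B : ℝ≥0∞),
      (∀ ζ, AEStronglyMeasurable (fun x => u x ζ) μ) → (∀ᵐ x ∂μ, u x ∈ V₁.below γ₁) →
      (∀ ζ, AEStronglyMeasurable (fun x => v x ζ) μ) → (∀ᵐ x ∂μ, v x ∈ V₂.below γ₂) →
      (∀ ζ, Measurable (w₁ ζ)) → (∀ ζ, Measurable (w₂ ζ)) →
      (∀ᵐ x ∂μ, ∀ q ∈ R.levels α₁ γ₁ ×ˢ R.levels α₂ γ₂, (q.1 : ℝ) + q.2 = ν →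
        0 < w₁ q.1 x ∧ 0 < w₂ q.2 x ∧ w₁ q.1 x * w₂ q.2 x ≤ w x) →
      (∀ᵐ x ∂μ, 0 ≤ w x) →
      (∀ ζ ∈ R.levels α₁ γ₁, weightedNorm μ p₁ (w₁ ζ) (fun x => u x ζ) ≤ A) →
      (∀ ζ ∈ R.levels α₂ γ₂, weightedNorm μ p₂ (w₂ ζ) (fun x => v x ζ) ≤ B) →
      weightedNorm μ p w (fun x => P.mul (u x) (v x) ν) ≤ C * (A * B) := by
  obtain ⟨K, hK⟩ := P.exists_norm_mul_le γ₁ γ₂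
  set S := R.levels α₁ γ₁ ×ˢ R.levels α₂ γ₂ with hS
  lift lpSumConst p S.card to ℝ≥0 using lpSumConst_ne_top _ _ with D hD
  refine ⟨D * (S.card * K), ?_⟩
  intro X _ μ u v w₁ w₂ w ν A B hu hu' hv hv' hw₁ hw₂ hw hw₀ hA hB
  let f : R.A × R.A → X → ℝ := fun q x => K * (‖u x q.1‖ / w₁ q.1 x) * (‖v x q.2‖ / w₂ q.2 x)
  have hm₁ : ∀ ζ, AEStronglyMeasurable (fun x => ‖u x ζ‖ / w₁ ζ x) μ := fun ζ =>
    ((hu ζ).norm.aemeasurable.div (hw₁ ζ).aemeasurable).aestronglyMeasurable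
  have hm₂ : ∀ ζ, AEStronglyMeasurable (fun x => ‖v x ζ‖ / w₂ ζ x) μ := fun ζ =>
    ((hv ζ).norm.aemeasurable.div (hw₂ ζ).aemeasurable).aestronglyMeasurable
  have hf : ∀ q, AEStronglyMeasurable (f q) μ := fun q =>
    ((hm₁ q.1).const_mul _).mul (hm₂ q.2)
  have hfb : ∀ q ∈ S, eLpNorm (f q) p μ ≤ K * (A * B) := by
    intro q hq
    obtain ⟨h₁, h₂⟩ := Finset.mem_product.1 hq
    refine (eLpNorm_le_eLpNorm_mul_eLpNorm'_of_norm (p := p₁) (q := p₂) (r := p) (hm₁ q.1) (hm₂ q.2) (fun a b => K * a * b) K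
      (Filter.Eventually.of_forall fun x => ?_)).trans ?_
    · simp
    · rw [mul_assoc]
      gcongr
      · exact hA _ h₁
      · exact hB _ h₂
  calc weightedNorm μ p w (fun x => P.mul (u x) (v x) ν)
      ≤ eLpNorm (fun x => ∑ q ∈ S with (q.1 : ℝ) + q.2 = ν, f q x) p μ := by
        refine eLpNorm_mono_ae_real ?_
        filter_upwards [hu', hv', hw, hw₀] with x h₁ h₂ h₃ h₄
        rw [Real.norm_of_nonneg (by positivity), P.mul_apply_eq_sum h₁ h₂]
        refine (div_le_div_of_nonneg_right (norm_sum_le _ _) h₄).trans ?_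
        rw [Finset.sum_div]
        refine Finset.sum_le_sum fun q hq => ?_
        obtain ⟨hq, hqν⟩ := Finset.mem_filter.1 hq
        obtain ⟨h₅, h₆, h₇⟩ := h₃ q hq hqν
        have h₈ := hK q hq ν hqν _ (h₁ q.1).1 _ (h₂ q.2).1
        calc _ ≤ K * ‖u x q.1‖ * ‖v x q.2‖ / (w₁ q.1 x * w₂ q.2 x) := by gcongr
          _ = f q x := by simp only [f]; field_simp
    _ ≤ lpSumConst p S.card * ∑ q ∈ S, eLpNorm (f q) p μ := by
        refine (eLpNorm_sum_le_lpSumConst _ p fun q _ => hf q).trans ?_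
        gcongr
        · exact lpSumConst_mono p (Finset.card_filter_le _ _)
        · exact Finset.filter_subset _ _
    _ ≤ D * ∑ q ∈ S, K * (A * B) := by
        rw [hD]
        gcongr with q hq
        exact hfb q hq
    _ = _ := by
        rw [Finset.sum_const, nsmul_eq_mul]
        push_cast
        ring

end SectorProduct

/-! ### Translations on the torus. -/

section Torus

variable {d : ℕ}

theorem measurePreserving_fract_add (c : ℝ) :
    MeasurePreserving (fun x : ℝ => Int.fract (x + c)) (volume.restrict (Ico 0 1))
      (volume.restrict (Ico 0 1)) := by
  have hmeas : Measurable fun x : ℝ => Int.fract (x + c) := measurable_fract.comp (by fun_prop)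
  refine ⟨hmeas, ?_⟩
  ext s hs
  rw [Measure.map_apply hmeas hs, Measure.restrict_apply (hmeas hs), Measure.restrict_apply hs]
  -- The set `A` is 1-periodic, and all unit intervals are fundamental domains for integer
  -- translations, so `A` has the same measure in each. The passage between `Ico` and `Ioc` only
  -- changes a null set.
  set A : Set ℝ := Int.fract ⁻¹' s with hA
  have hAm : MeasurableSet A := measurable_fract hs
  have hIoc : ∀ a : ℝ, volume (A ∩ Ico a (a + 1)) = volume (A ∩ Ioc a (a + 1)) := fun a =>
    measure_congr ((Filter.EventuallyEq.refl _ A).inter Ico_ae_eq_Ioc)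
  have hinv : ∀ g : AddSubgroup.zmultiples (1 : ℝ), (fun x => g +ᵥ x) ⁻¹' A = A := by
    rintro ⟨_, n, rfl⟩
    ext x
    simp only [hA, mem_preimage, AddSubgroup.vadd_def, vadd_eq_add, zsmul_eq_mul, mul_one]
    rw [add_comm, Int.fract_add_intCast]
  calc volume ((fun x : ℝ => Int.fract (x + c)) ⁻¹' s ∩ Ico 0 1)
      = volume ((fun x => x + c) ⁻¹' (A ∩ Ico c (c + 1))) := by
        congr 1
        ext x
        simp only [hA, mem_inter_iff, mem_preimage, mem_Ico]
        constructor <;> rintro ⟨h, h₁, h₂⟩ <;> exact ⟨h, by linarith, by linarith⟩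
    _ = volume (A ∩ Ico c (c + 1)) := measure_preimage_add_right _ _ _
    _ = volume (A ∩ Ico 0 (0 + 1)) := by
        rw [hIoc, hIoc]
        exact (isAddFundamentalDomain_Ioc one_pos c).measure_set_eq
          (isAddFundamentalDomain_Ioc one_pos 0) hAm hinv
    _ = volume (s ∩ Ico 0 1) := by
        congr 1
        ext x
        rw [zero_add]
        simp only [hA, mem_inter_iff, mem_preimage]
        refine and_congr_left fun hx => ?_
        rw [Int.fract_eq_self.2 hx]

/-- Translation by `h`, with the space variables reduced to the cell `[0, 1)^d`. -/
def torusShift (h z : SpaceTime d) : SpaceTime d :=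
  (z.1 + h.1, fun i => Int.fract (z.2 i + h.2 i))

theorem torusSlab_eq_prod (a b : ℝ) : torusSlab d a b =
    (volume.restrict (Ioo a b)).prod (Measure.pi fun _ : Fin d => volume.restrict (Ico (0 : ℝ) 1)) := by
  rw [torusSlab, Measure.volume_eq_prod, ← Measure.prod_restrict, volume_pi,
    Measure.restrict_pi_pi]

theorem measurePreserving_torusShift (h : SpaceTime d) (a b : ℝ) :
    MeasurePreserving (torusShift h) (torusSlab d a b) (torusSlab d (a + h.1) (b + h.1)) := by
  rw [torusSlab_eq_prod, torusSlab_eq_prod]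
  refine MeasurePreserving.prod (f := fun t => t + h.1)
    (g := fun (x : Fin d → ℝ) i => Int.fract (x i + h.2 i)) ?_ ?_
  · have := (measurePreserving_add_right volume h.1).restrict_preimage
      (measurableSet_Ioo (a := a + h.1) (b := b + h.1))
    simpa using this
  · exact measurePreserving_pi _ _ fun i => measurePreserving_fract_add (h.2 i)

theorem torusSlab_mono {a b a' b' : ℝ} (ha : a' ≤ a) (hb : b ≤ b') :
    torusSlab d a b ≤ torusSlab d a' b' :=
  Measure.restrict_mono (prod_mono (Ioo_subset_Ioo ha hb) Subset.rfl) le_rfl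

theorem ae_torusSlab {a b : ℝ} {Q : SpaceTime d → Prop}
    (hQ : ∀ z : SpaceTime d, z.1 ∈ Ioo a b → (∀ i, z.2 i ∈ Ico (0 : ℝ) 1) → Q z) :
    ∀ᵐ z ∂torusSlab d a b, Q z := by
  refine ae_restrict_of_forall_mem
    (measurableSet_Ioo.prod (MeasurableSet.univ_pi fun _ => measurableSet_Ico)) ?_
  rintro z ⟨h₁, h₂⟩
  exact hQ z h₁ fun i => h₂ i (mem_univ i)

theorem torusSlab_le (a b : ℝ) : torusSlab d a b ≤ volume.restrict (Ioo a b ×ˢ univ) :=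
  Measure.restrict_mono (prod_mono Subset.rfl (subset_univ _)) le_rfl

/-- The points `z + h` and `torusShift h z` differ by an integer vector in space, so a periodic
function takes the same value at both, and `torusShift` preserves the measure. -/
theorem eLpNorm_shift_le {T : ℝ} (G : SpaceTime d → ℝ) (h : SpaceTime d) {a b : ℝ} (p : ℝ≥0∞)
    (ha : 0 ≤ a + h.1) (hb : b + h.1 ≤ T) (hG : AEStronglyMeasurable G (torusSlab d 0 T))
    (hper : ∀ t ∈ Ioo 0 T, ∀ (x : Fin d → ℝ) (k : Fin d → ℤ),
      G (t, x + fun i => (k i : ℝ)) = G (t, x)) :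
    eLpNorm (fun z => G (z + h)) p (torusSlab d a b) ≤ eLpNorm G p (torusSlab d 0 T) := by
  have hle := torusSlab_mono (d := d) ha hb
  refine le_trans (le_of_eq ?_) (eLpNorm_mono_measure G hle)
  rw [← eLpNorm_comp_measurePreserving (hG.mono_measure hle) (measurePreserving_torusShift h a b)]
  refine eLpNorm_congr_ae (ae_torusSlab fun z hz _ => ?_)
  have := hper (z.1 + h.1) ⟨by linarith [hz.1], by linarith [hz.2]⟩
    (torusShift h z).2 (fun i => ⌊z.2 i + h.2 i⌋)
  refine Eq.trans ?_ this
  refine congrArg G (Prod.ext rfl ?_)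
  ext i
  simp [torusShift, Int.fract_add_floor]

theorem aestronglyMeasurable_shift {T : ℝ} {E : Type*} [NormedAddCommGroup E]
    {G : SpaceTime d → E} (h : SpaceTime d) {a b : ℝ}
    (ha : 0 ≤ a + h.1) (hb : b + h.1 ≤ T)
    (hG : AEStronglyMeasurable G (volume.restrict (Ioo 0 T ×ˢ univ))) :
    AEStronglyMeasurable (fun z => G (z + h)) (torusSlab d a b) := by
  have : (volume : Measure (SpaceTime d)).IsAddRightInvariant := by
    rw [Measure.volume_eq_prod]
    infer_instance
  have hmp := (measurePreserving_add_right (volume : Measure (SpaceTime d)) h).restrict_preimage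
    ((measurableSet_Ioo (a := (0 : ℝ)) (b := T)).prod (MeasurableSet.univ (α := Fin d → ℝ)))
  refine (hG.comp_measurePreserving hmp).mono_measure (Measure.restrict_mono ?_ le_rfl)
  rintro z ⟨h₁, -⟩
  exact ⟨⟨by simpa using by linarith [h₁.1], by simpa using by linarith [h₁.2]⟩, mem_univ _⟩

end Torus

/-! ### The parabolic distance and the size of `Γ`. -/

section ParNorm

variable {d : ℕ}

theorem parNorm_nonneg (z : SpaceTime d) : 0 ≤ parNorm z := le_max_of_le_left (Real.sqrt_nonneg _)

theorem parNorm_zero : parNorm (0 : SpaceTime d) = 0 := by simp [parNorm]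

theorem continuous_parNorm : Continuous (parNorm (d := d)) := by
  unfold parNorm
  fun_prop

theorem abs_fst_le_parNorm_sq (z : SpaceTime d) : |z.1| ≤ parNorm z ^ 2 := by
  calc |z.1| = Real.sqrt |z.1| ^ 2 := (Real.sq_sqrt (abs_nonneg _)).symm
    _ ≤ _ := by
      gcongr
      exact le_max_left _ _

theorem abs_snd_le_parNorm (z : SpaceTime d) (i : Fin d) : |z.2 i| ≤ parNorm z :=
  (norm_le_pi_norm z.2 i).trans (le_max_right _ _)

end ParNorm

section GammaSize

variable {d : ℕ} {R : RegularityStructure.{u}}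

theorem le_gammaSize {Γ : SpaceTime d → SpaceTime d → R.Space →ₗ[ℝ] R.Space} {γ : ℝ}
    {K : Set (SpaceTime d)} {z z' : SpaceTime d} (hz : z ∈ K) (hz' : z' ∈ K)
    (h : parNorm (z - z') ≤ 1) {ζ ν : R.A} (hζ : (ζ : ℝ) < γ) (hν : ν ≤ ζ) (τ : R.Level ζ) :
    ENNReal.ofReal (‖Γ z z' (DFinsupp.single ζ τ) ν‖ /
      (‖τ‖ * parNorm (z - z') ^ ((ζ : ℝ) - ν))) ≤ gammaSize Γ γ K := by
  unfold gammaSize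
  exact le_iSup_of_le z <| le_iSup_of_le hz <| le_iSup_of_le z' <| le_iSup_of_le hz' <|
    le_iSup_of_le h <| le_iSup_of_le ζ <| le_iSup_of_le ν <| le_iSup_of_le hζ <|
    le_iSup_of_le hν <| le_iSup_of_le τ le_rfl

/-- For `ν < ζ` the quotient in `gammaSize` is zero by convention when the points coincide and then
carries no information, hence the positivity of the distance. -/
theorem norm_apply_single_le {Γ : SpaceTime d → SpaceTime d → R.Space →ₗ[ℝ] R.Space} {γ : ℝ}
    {K : Set (SpaceTime d)} (hfin : gammaSize Γ γ K ≠ ∞) {z z' : SpaceTime d} (hz : z ∈ K)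
    (hz' : z' ∈ K) (h : parNorm (z - z') ≤ 1) (h₀ : 0 < parNorm (z - z'))
    {ζ ν : R.A} (hζ : (ζ : ℝ) < γ) (hν : ν ≤ ζ) (τ : R.Level ζ) :
    ‖Γ z z' (DFinsupp.single ζ τ) ν‖ ≤
      (gammaSize Γ γ K).toNNReal * ‖τ‖ * parNorm (z - z') ^ ((ζ : ℝ) - ν) := by
  rcases eq_or_ne τ 0 with rfl | hτ
  · simp
  have hpos : 0 < ‖τ‖ * parNorm (z - z') ^ ((ζ : ℝ) - ν) :=
    mul_pos (norm_pos_iff.2 hτ) (Real.rpow_pos_of_pos h₀ _)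
  have := le_gammaSize (Γ := Γ) hz hz' h hζ hν τ
  rw [ENNReal.ofReal_le_iff_le_toReal hfin, div_le_iff₀ hpos] at this
  rw [mul_assoc]
  exact this

theorem gammaSize_sub_le (Γ Γ' : SpaceTime d → SpaceTime d → R.Space →ₗ[ℝ] R.Space) (γ : ℝ)
    (K : Set (SpaceTime d)) :
    gammaSize (fun z z' => Γ z z' - Γ' z z') γ K ≤ gammaSize Γ γ K + gammaSize Γ' γ K := by
  conv_lhs => unfold gammaSize
  simp only [iSup_le_iff]
  intro z hz z' hz' h ζ ν hζ hν τ
  refine le_trans ?_ (add_le_add (le_gammaSize hz hz' h hζ hν τ) (le_gammaSize hz hz' h hζ hν τ))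
  have hnn : 0 ≤ ‖τ‖ * parNorm (z - z') ^ ((ζ : ℝ) - ν) :=
    mul_nonneg (norm_nonneg _) (Real.rpow_nonneg (parNorm_nonneg _) _)
  rw [← ENNReal.ofReal_add (by positivity) (by positivity), ← add_div]
  refine ENNReal.ofReal_le_ofReal (div_le_div_of_nonneg_right ?_ hnn)
  rw [LinearMap.sub_apply, DFinsupp.sub_apply]
  exact norm_sub_le _ _

theorem isBounded_cellNhd (T : ℝ) : Bornology.IsBounded (cellNhd d T) :=
  Bornology.IsBounded.prod (Metric.isBounded_Ioo 0 T)
    (Bornology.IsBounded.pi fun _ => Metric.isBounded_Icc (-1) 2)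

end GammaSize

/-! ### Continuity of `Γ` in its two points, and the resulting measurability. -/

section Continuity

variable {R : RegularityStructure.{u}}

/-- The sector formed by the whole space. -/
def Sector.univ {α : ℝ} (h : ∀ ζ : R.A, α ≤ ζ) : Sector R α where
  V _ := ⊤
  eq_bot ζ hζ := absurd hζ (not_lt.2 (h ζ))
  invariant _ _ _ _ _ _ := trivial

theorem continuousAt_apply_graded {Y : Type*} [TopologicalSpace Y] {y₀ : Y} {S : Finset R.A}
    {v : Y → R.Space} (hS : ∀ y ζ, ζ ∉ S → v y ζ = 0)
    (hv : ∀ ζ, ContinuousAt (fun y => v y ζ) y₀) {L : Y → R.Space →ₗ[ℝ] R.Space} (ν : R.A)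
    (hL : ∀ ζ : R.A, ContinuousAt
      (fun q : Y × R.Level ζ => L q.1 (DFinsupp.single ζ q.2) ν) (y₀, v y₀ ζ)) :
    ContinuousAt (fun y => L y (v y) ν) y₀ := by
  have heq : (fun y => L y (v y) ν) =
      fun y => ∑ ζ ∈ S, L y (DFinsupp.single ζ (v y ζ)) ν := by
    funext y
    rw [apply_eq_sum (hS y), DFinsupp.finsetSum_apply]
  rw [heq]
  refine tendsto_finsetSum _ fun ζ _ => ?_
  exact ContinuousAt.comp (f := fun y => (y, v y ζ)) (hL ζ) (continuousAt_id.prodMk (hv ζ))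

namespace Model

variable {d r : ℕ} (M : Model d r R)

theorem Γ_self (z : SpaceTime d) (τ : R.Space) : M.Γ z z τ = τ :=
  (M.Γ z z).injective (M.cocycle z z z τ)

/-- Above the level `ζ` the component vanishes, at `ζ` it is the identity, and below `ζ` the
analytic bound contains a positive power of the distance, which tends to zero. -/
theorem continuousAt_Γ_diagonal (z : SpaceTime d) (ζ ν : R.A) (τ : R.Level ζ) :
    ContinuousAt (fun q : (SpaceTime d × SpaceTime d) × R.Level ζ =>
      M.Γ q.1.1 q.1.2 (DFinsupp.single ζ q.2) ν) ((z, z), τ) := by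
  rcases lt_trichotomy ζ ν with h | rfl | h
  · simp only [apply_single_eq_zero (M.mem_G _ _) h]
    exact continuousAt_const
  · simp only [apply_single_same (M.mem_G _ _)]
    exact continuousAt_snd
  · have hfin := (M.Γ_bound (ζ + 1) (Metric.ball z 1) Metric.isBounded_ball).ne
    set N := (gammaSize (fun z z' => (M.Γ z z' : R.Space →ₗ[ℝ] R.Space)) (ζ + 1)
      (Metric.ball z 1)).toNNReal
    have hpos : 0 < (ζ : ℝ) - ν := sub_pos.2 h
    have hcont : Continuous fun q : (SpaceTime d × SpaceTime d) × R.Level ζ =>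
        parNorm (q.1.1 - q.1.2) := continuous_parNorm.comp (by fun_prop)
    have hlim : Filter.Tendsto (fun q : (SpaceTime d × SpaceTime d) × R.Level ζ =>
        N * ‖q.2‖ * parNorm (q.1.1 - q.1.2) ^ ((ζ : ℝ) - ν)) (nhds ((z, z), τ)) (nhds 0) := by
      have hc : Continuous fun q : (SpaceTime d × SpaceTime d) × R.Level ζ =>
          N * ‖q.2‖ * parNorm (q.1.1 - q.1.2) ^ ((ζ : ℝ) - ν) :=
        (by fun_prop : Continuous fun q : (SpaceTime d × SpaceTime d) × R.Level ζ =>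
          N * ‖q.2‖).mul (hcont.rpow_const fun _ => Or.inr hpos.le)
      have := hc.tendsto ((z, z), τ)
      simpa [parNorm_zero, Real.zero_rpow hpos.ne'] using this
    have hval : M.Γ z z (DFinsupp.single ζ τ) ν = 0 := by
      rw [M.Γ_self, DFinsupp.single_eq_of_ne h.ne]
    unfold ContinuousAt
    simp only [hval]
    refine squeeze_zero_norm' ?_ hlim
    have h₁ : ∀ᶠ q : (SpaceTime d × SpaceTime d) × R.Level ζ in nhds ((z, z), τ),
        parNorm (q.1.1 - q.1.2) < 1 :=
      (hcont.tendsto ((z, z), τ)).eventually_lt_const (by simp [parNorm_zero])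
    have h₂ : ∀ᶠ q : (SpaceTime d × SpaceTime d) × R.Level ζ in nhds ((z, z), τ),
        q.1.1 ∈ Metric.ball z 1 :=
      (continuous_fst.comp continuous_fst).continuousAt.eventually
        (Metric.ball_mem_nhds z one_pos)
    have h₃ : ∀ᶠ q : (SpaceTime d × SpaceTime d) × R.Level ζ in nhds ((z, z), τ),
        q.1.2 ∈ Metric.ball z 1 :=
      (continuous_snd.comp continuous_fst).continuousAt.eventually
        (Metric.ball_mem_nhds z one_pos)
    filter_upwards [h₁, h₂, h₃] with q hq₁ hq₂ hq₃
    rcases (parNorm_nonneg (q.1.1 - q.1.2)).eq_or_lt with h₀ | h₀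
    · have hq : q.1.1 = q.1.2 := by
        have hs := max_le_iff.1 (show max _ _ ≤ (0 : ℝ) from h₀.ge)
        have ha : |(q.1.1 - q.1.2).1| ≤ 0 := Real.sqrt_eq_zero'.1 (le_antisymm hs.1 (by positivity))
        refine sub_eq_zero.1 (Prod.ext ?_ ?_)
        · exact abs_nonpos_iff.1 ha
        · exact norm_le_zero_iff.1 hs.2
      rw [hq, M.Γ_self, DFinsupp.single_eq_of_ne h.ne, norm_zero]
      exact mul_nonneg (by positivity) (Real.rpow_nonneg (parNorm_nonneg _) _)
    · exact norm_apply_single_le (Γ := fun z z' => (M.Γ z z' : R.Space →ₗ[ℝ] R.Space)) hfin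
        hq₂ hq₃ hq₁.le h₀ (by linarith) h.le q.2

/-- The maps `Γ` of a model depend continuously on the two points. -/
theorem continuous_Γ (ζ ν : R.A) :
    Continuous fun q : (SpaceTime d × SpaceTime d) × R.Level ζ =>
      M.Γ q.1.1 q.1.2 (DFinsupp.single ζ q.2) ν := by
  rw [continuous_iff_continuousAt]
  rintro ⟨⟨z, z'⟩, τ⟩
  obtain ⟨α, hα⟩ := R.bddBelow
  let U : Sector R α := Sector.univ fun ζ => hα ζ.2
  have hmem : ∀ τ : R.Level ζ, (DFinsupp.single ζ τ : R.Space) ∈ U.below (ζ + 1) := fun τ =>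
    Sector.single_mem_below (Submodule.mem_top) (by linarith)
  -- Near `(z, z')` the cocycle relation factors `Γ_{x,y}` as `Γ_{x,z} Γ_{z,z'} Γ_{z',y}`: the outer
  -- maps are near the diagonal and the middle one is a fixed continuous map.
  let v₁ : (SpaceTime d × SpaceTime d) × R.Level ζ → R.Space := fun q => M.Γ z' q.1.2 (DFinsupp.single ζ q.2)
  let v₂ : (SpaceTime d × SpaceTime d) × R.Level ζ → R.Space := fun q => M.Γ z z' (v₁ q)
  have hm₁ : ∀ q, v₁ q ∈ U.below (ζ + 1) := fun q =>
    Sector.apply_mem_below (M.mem_G _ _) (hmem q.2)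
  have hm₂ : ∀ q, v₂ q ∈ U.below (ζ + 1) := fun q => Sector.apply_mem_below (M.mem_G _ _) (hm₁ q)
  have heq : (fun q : (SpaceTime d × SpaceTime d) × R.Level ζ => M.Γ q.1.1 q.1.2 (DFinsupp.single ζ q.2) ν) =
      fun q => (M.Γ q.1.1 z : R.Space →ₗ[ℝ] R.Space) (v₂ q) ν := by
    funext q
    simp only [v₁, v₂, LinearEquiv.coe_coe, M.cocycle]
  have hc₁ : ∀ μ, ContinuousAt (fun q => v₁ q μ) ((z, z'), τ) := fun μ =>
    ContinuousAt.comp_of_eq (f := fun q : (SpaceTime d × SpaceTime d) × R.Level ζ =>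
      ((z', q.1.2), q.2))
      (M.continuousAt_Γ_diagonal z' ζ μ τ) (by fun_prop) rfl
  have hc₂ : ∀ μ, ContinuousAt (fun q => v₂ q μ) ((z, z'), τ) := fun μ =>
    continuousAt_apply_graded (fun q => Sector.eq_zero_of_notMem_levels (hm₁ q)) hc₁
      (L := fun _ => (M.Γ z z' : R.Space →ₗ[ℝ] R.Space)) μ fun ζ' =>
      ((R.continuous_of_mem _ (M.mem_G z z') ζ' μ).comp continuous_snd).continuousAt
  rw [heq]
  refine continuousAt_apply_graded (fun q => Sector.eq_zero_of_notMem_levels (hm₂ q)) hc₂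
      (L := fun q => (M.Γ q.1.1 z : R.Space →ₗ[ℝ] R.Space)) ν fun ζ' => ?_
  exact ContinuousAt.comp_of_eq (f := fun q : ((SpaceTime d × SpaceTime d) × R.Level ζ) × R.Level ζ' =>
      ((q.1.1.1, z), q.2))
    (M.continuousAt_Γ_diagonal z ζ' ν _) (by fun_prop) rfl

theorem aestronglyMeasurable_Γ_single {μ : Measure (SpaceTime d)} (h : SpaceTime d) (ζ ν : R.A)
    {v : SpaceTime d → R.Level ζ} (hv : AEStronglyMeasurable v μ) :
    AEStronglyMeasurable (fun z => M.Γ (z + h) z (DFinsupp.single ζ (v z)) ν) μ :=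
  (M.continuous_Γ ζ ν).comp_aestronglyMeasurable
    ((by fun_prop : Continuous fun z : SpaceTime d => (z + h, z)).aestronglyMeasurable.prodMk hv)

theorem aestronglyMeasurable_Γ {μ : Measure (SpaceTime d)} (h : SpaceTime d) {α γ : ℝ}
    {V : Sector R α} {v : SpaceTime d → R.Space}
    (hv : ∀ ζ, AEStronglyMeasurable (fun z => v z ζ) μ) (hv' : ∀ᵐ z ∂μ, v z ∈ V.below γ)
    (ν : R.A) : AEStronglyMeasurable (fun z => M.Γ (z + h) z (v z) ν) μ := by
  refine AEStronglyMeasurable.congr (Finset.aestronglyMeasurable_fun_sum (R.levels α γ)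
    fun ζ _ => M.aestronglyMeasurable_Γ_single h ζ ν (hv ζ)) ?_
  filter_upwards [hv'] with z hz
  have := apply_eq_sum (Sector.eq_zero_of_notMem_levels hz)
    (M.Γ (z + h) z : R.Space →ₗ[ℝ] R.Space)
  rw [LinearEquiv.coe_coe] at this
  rw [this, DFinsupp.finsetSum_apply]

end Model

end Continuity

/-! ### The interpolating weights. -/

section Weights

variable {d : ℕ}

/-- The weight `|h|^{s-ζ} t^{(η-s)/2}`. -/
def parWeight (h : SpaceTime d) (η s ζ : ℝ) (z : SpaceTime d) : ℝ :=
  parNorm h ^ (s - ζ) * z.1 ^ ((η - s) / 2)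

theorem measurable_parWeight (h : SpaceTime d) (η s ζ : ℝ) : Measurable (parWeight h η s ζ) := by
  unfold parWeight
  fun_prop

theorem parWeight_pos {h z : SpaceTime d} (hh : 0 < parNorm h) (hz : 0 < z.1) (η s ζ : ℝ) :
    0 < parWeight h η s ζ z := mul_pos (Real.rpow_pos_of_pos hh _) (Real.rpow_pos_of_pos hz _)

theorem parWeight_self (h : SpaceTime d) (η ζ : ℝ) (z : SpaceTime d) :
    parWeight h η ζ ζ z = z.1 ^ ((η - ζ) / 2) := by simp [parWeight]

/-- Raising `s'` to `s` multiplies the weight by `(|h|² / t)^{(s-s')/2}`, which is at most one. -/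
theorem parWeight_antitone {h z : SpaceTime d} (hh : 0 < parNorm h) (hz : parNorm h ^ 2 ≤ z.1)
    (η ζ : ℝ) {s s' : ℝ} (hs : s' ≤ s) : parWeight h η s ζ z ≤ parWeight h η s' ζ z := by
  have hz₀ : 0 < z.1 := (pow_pos hh 2).trans_le hz
  have h₁ : parNorm h ^ (s - ζ) = parNorm h ^ (s' - ζ) * parNorm h ^ (s - s') := by
    rw [← Real.rpow_add hh]; ring_nf
  have h₂ : z.1 ^ ((η - s') / 2) = z.1 ^ ((s - s') / 2) * z.1 ^ ((η - s) / 2) := by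
    rw [← Real.rpow_add hz₀]; ring_nf
  have h₃ : parNorm h ^ (s - s') ≤ z.1 ^ ((s - s') / 2) := by
    have : parNorm h ^ (s - s') = (parNorm h ^ 2) ^ ((s - s') / 2) := by
      rw [← Real.rpow_natCast, ← Real.rpow_mul hh.le]
      congr 1
      push_cast
      ring
    rw [this]
    exact Real.rpow_le_rpow (by positivity) hz (by linarith)
  unfold parWeight
  rw [h₁, h₂, mul_assoc]
  gcongr

theorem parWeight_mul {h z : SpaceTime d} (hh : 0 < parNorm h) (hz : 0 < z.1)
    (η₁ η₂ s₁ s₂ ζ₁ ζ₂ : ℝ) : parWeight h η₁ s₁ ζ₁ z * parWeight h η₂ s₂ ζ₂ z =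
      parWeight h (η₁ + η₂) (s₁ + s₂) (ζ₁ + ζ₂) z := by
  unfold parWeight
  have h₁ : s₁ + s₂ - (ζ₁ + ζ₂) = (s₁ - ζ₁) + (s₂ - ζ₂) := by ring
  have h₂ : (η₁ + η₂ - (s₁ + s₂)) / 2 = (η₁ - s₁) / 2 + (η₂ - s₂) / 2 := by ring
  rw [h₁, h₂, Real.rpow_add hh, Real.rpow_add hz]
  ring

end Weights

/-! ### Action of `Γ_{z+h,z}` on weighted norms. -/

section Transport

variable {d : ℕ} {R : RegularityStructure.{u}}

/-- A family of lower triangular maps with the bounds of the maps `Γ_{z+h,z}` of a model. -/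
def IsTransport (μ : Measure (SpaceTime d)) (h : SpaceTime d) (c : ℝ) (N : ℝ≥0)
    (L : SpaceTime d → R.Space →ₗ[ℝ] R.Space) : Prop :=
  ∀ᵐ z ∂μ, ∀ ζ ν : R.A, (ζ : ℝ) < c → ∀ τ : R.Level ζ,
    (ν ≤ ζ → ‖L z (DFinsupp.single ζ τ) ν‖ ≤ N * ‖τ‖ * parNorm h ^ ((ζ : ℝ) - ν)) ∧
      (ζ < ν → L z (DFinsupp.single ζ τ) ν = 0)

variable {μ : Measure (SpaceTime d)} {h : SpaceTime d} {c : ℝ} {N : ℝ≥0}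
  {L : SpaceTime d → R.Space →ₗ[ℝ] R.Space} {q : ℝ≥0∞} {η : ℝ}

/-- The factor `|h|^{ζ-ν}` in the bound on `Γ` is exactly the ratio of the two weights. -/
theorem IsTransport.weightedNorm_single_le (hL : IsTransport μ h c N L) (hh : 0 < parNorm h)
    (hμ : ∀ᵐ z ∂μ, 0 < z.1) {ζ : R.A} (hζ : (ζ : ℝ) < c) (v : SpaceTime d → R.Level ζ) (ν : R.A) :
    weightedNorm μ q (parWeight h η ζ ν) (fun z => L z (DFinsupp.single ζ (v z)) ν) ≤
      N * weightedNorm μ q (parWeight h η ζ ζ) v := by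
  refine weightedNorm_le_mul N ?_
  filter_upwards [hL, hμ] with z hz hz₀
  have hw := parWeight_pos hh hz₀ η ζ ν
  have hw' := parWeight_pos hh hz₀ η ζ ζ
  refine ⟨hw.le, hw'.le, ?_⟩
  obtain ⟨h₁, h₂⟩ := hz ζ ν hζ (v z)
  rcases le_or_gt ν ζ with hν | hν
  · refine (div_le_div_of_nonneg_right (h₁ hν) hw.le).trans (le_of_eq ?_)
    rw [parWeight_self, parWeight]
    have := Real.rpow_pos_of_pos hh (ζ - ν)
    have := Real.rpow_pos_of_pos hz₀ ((η - ζ) / 2)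
    field_simp
  · rw [h₂ hν, norm_zero, zero_div]
    positivity

theorem IsTransport.weightedNorm_le (hL : IsTransport μ h c N L) (hh : 0 < parNorm h)
    (hμ : ∀ᵐ z ∂μ, parNorm h ^ 2 ≤ z.1) {α γ : ℝ} {V : Sector R α} (hγ : γ ≤ c)
    {v : SpaceTime d → R.Space} (hv : ∀ᵐ z ∂μ, v z ∈ V.below γ) (ν : R.A)
    (hm : ∀ ζ, AEStronglyMeasurable (fun z => L z (DFinsupp.single ζ (v z ζ)) ν) μ) {B : ℝ≥0∞}
    (hB : ∀ ζ ∈ R.levels α γ, weightedNorm μ q (parWeight h η ζ ζ) (fun z => v z ζ) ≤ B) :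
    weightedNorm μ q (parWeight h η ν ν) (fun z => L z (v z) ν) ≤
      lpSumConst q (R.levels α γ).card * (R.levels α γ).card * (N * B) := by
  have hμ₀ : ∀ᵐ z ∂μ, 0 < z.1 := hμ.mono fun z hz => (pow_pos hh 2).trans_le hz
  have hpos : ∀ s ζ, ∀ᵐ z ∂μ, 0 ≤ parWeight h η s ζ z := fun s ζ =>
    hμ₀.mono fun z hz => (parWeight_pos hh hz η s ζ).le
  rw [weightedNorm_congr (Filter.Eventually.of_forall fun z => rfl)
    (G := fun z => ∑ ζ ∈ R.levels α γ, L z (DFinsupp.single ζ (v z ζ)) ν)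
    (hv.mono fun z hz => by
      rw [apply_eq_sum (Sector.eq_zero_of_notMem_levels hz) (L z), DFinsupp.finsetSum_apply])]
  refine (weightedNorm_sum_le _ (fun ζ _ => hm ζ) (measurable_parWeight _ _ _ _).aemeasurable
    (hpos ν ν)).trans ?_
  rw [mul_assoc]
  gcongr
  rw [← nsmul_eq_mul]
  refine Finset.sum_le_card_nsmul _ _ _ fun ζ hζ => ?_
  have hζc : (ζ : ℝ) < c := (mem_levels.1 hζ).2.trans_le hγ
  refine le_trans ?_ ((hL.weightedNorm_single_le (q := q) (η := η) hh hμ₀ hζc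
    (fun z => v z ζ) ν).trans ?_)
  -- Only source levels `ζ ≥ ν` contribute, and for them the weight with `s = ζ` is at most the one
  -- with `s = ν`.
  · refine (weightedNorm_le_mul 1 ?_).trans_eq (by rw [ENNReal.coe_one, one_mul])
    filter_upwards [hμ, hμ₀, hL] with z hz hz₀ hLz
    have hw := parWeight_pos hh hz₀ η ζ ν
    have hw' := parWeight_pos hh hz₀ η ν ν
    refine ⟨hw'.le, hw.le, ?_⟩
    rw [NNReal.coe_one, one_mul]
    rcases le_or_gt ν ζ with hν | hν
    · exact div_le_div_of_nonneg_left (norm_nonneg _) hw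
        (parWeight_antitone hh hz η ν (Subtype.coe_le_coe.2 hν))
    · rw [(hLz ζ ν hζc _).2 hν, norm_zero, zero_div, zero_div]
  · gcongr
    exact hB ζ hζ

variable {r : ℕ}

theorem add_mem_cellNhd {T : ℝ} {h z : SpaceTime d} (hh : parNorm h < 1)
    (h₁ : z.1 ∈ Ioo (3 * parNorm h ^ 2) (T - parNorm h ^ 2))
    (h₂ : ∀ i, z.2 i ∈ Ico (0 : ℝ) 1) : z ∈ cellNhd d T ∧ z + h ∈ cellNhd d T := by
  have hsq : 0 ≤ parNorm h ^ 2 := sq_nonneg _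
  have hh₁ := abs_le.1 (abs_fst_le_parNorm_sq h)
  refine ⟨⟨⟨by linarith [h₁.1], by linarith [h₁.2]⟩, fun i _ => ?_⟩,
    ⟨by simpa using by linarith [h₁.1], by simpa using by linarith [h₁.2]⟩, fun i _ => ?_⟩
  · exact ⟨by linarith [(h₂ i).1], by linarith [(h₂ i).2]⟩
  · have hh₂ := abs_le.1 (abs_snd_le_parNorm h i)
    exact ⟨by simpa using by linarith [(h₂ i).1], by simpa using by linarith [(h₂ i).2]⟩

theorem isTransport_of_gammaSize {Γ : SpaceTime d → SpaceTime d → R.Space →ₗ[ℝ] R.Space} {T : ℝ}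
    (hfin : gammaSize Γ c (cellNhd d T) ≠ ∞) (hh : 0 < parNorm h) (hh' : parNorm h < 1)
    (htri : ∀ z z' (ζ ν : R.A) (τ : R.Level ζ), ζ < ν → Γ z z' (DFinsupp.single ζ τ) ν = 0) :
    IsTransport (torusSlab d (3 * parNorm h ^ 2) (T - parNorm h ^ 2)) h c
      (gammaSize Γ c (cellNhd d T)).toNNReal fun z => Γ (z + h) z := by
  refine ae_torusSlab fun z h₁ h₂ ζ ν hζ τ => ⟨fun hν => ?_, htri _ _ _ _ _⟩
  obtain ⟨hz, hz'⟩ := add_mem_cellNhd hh' h₁ h₂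
  have heq : z + h - z = h := add_sub_cancel_left z h
  have := norm_apply_single_le hfin hz' hz (by rw [heq]; exact hh'.le) (by rwa [heq]) hζ hν τ
  rwa [heq] at this

namespace Model

variable (M M' : Model d r R)

theorem normΓ_ne_top (T : ℝ) : M.normΓ c T ≠ ∞ := (M.Γ_bound c _ (isBounded_cellNhd T)).ne

theorem distΓ_ne_top (T : ℝ) : M.distΓ M' c T ≠ ∞ :=
  ne_top_of_le_ne_top (ENNReal.add_ne_top.2 ⟨M.normΓ_ne_top T, M'.normΓ_ne_top T⟩)
    (gammaSize_sub_le _ _ _ _)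

theorem isTransport (T : ℝ) (hh : 0 < parNorm h) (hh' : parNorm h < 1) :
    IsTransport (torusSlab d (3 * parNorm h ^ 2) (T - parNorm h ^ 2)) h c
      (M.normΓ c T).toNNReal fun z => (M.Γ (z + h) z : R.Space →ₗ[ℝ] R.Space) :=
  isTransport_of_gammaSize (M.normΓ_ne_top T) hh hh' fun _ _ _ _ τ hν =>
    apply_single_eq_zero (M.mem_G _ _) hν τ

theorem isTransport_sub (T : ℝ) (hh : 0 < parNorm h) (hh' : parNorm h < 1) :
    IsTransport (torusSlab d (3 * parNorm h ^ 2) (T - parNorm h ^ 2)) h c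
      (M.distΓ M' c T).toNNReal fun z =>
        (M.Γ (z + h) z : R.Space →ₗ[ℝ] R.Space) - (M'.Γ (z + h) z : R.Space →ₗ[ℝ] R.Space) :=
  isTransport_of_gammaSize (M.distΓ_ne_top M' T) hh hh' fun z z' ζ ν τ hν => by
    rw [LinearMap.sub_apply, DFinsupp.sub_apply, LinearEquiv.coe_coe, LinearEquiv.coe_coe,
      apply_single_eq_zero (M.mem_G _ _) hν τ, apply_single_eq_zero (M'.mem_G _ _) hν τ, sub_zero]

end Model

end Transport

/-! ### Bounds on values, shifted values and increments. -/

section ModelledDistributions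

variable {d r : ℕ} {R : RegularityStructure.{u}} {M M' : Model d r R} {α γ η T : ℝ} {p : ℝ≥0∞}
  {V : Sector R α} {f g : SpaceTime d → R.Space}

theorem weightedNorm_le_localDist (h : SpaceTime d) {ζ : R.A} (hζ : (ζ : ℝ) < γ) :
    weightedNorm (torusSlab d (3 * parNorm h ^ 2) (T - parNorm h ^ 2)) p (parWeight h η ζ ζ)
      (fun z => (f z - g z) ζ) ≤ localDist γ η T p f g := by
  refine le_trans ?_ (le_iSup₂_of_le ζ hζ le_rfl)
  simp only [weightedNorm, parWeight_self]
  exact eLpNorm_mono_measure _ (torusSlab_mono (by positivity) (by linarith [sq_nonneg (parNorm h)]))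

/-- The ratio `(t + s) / t` lies between `1/2` and `3/2`, so both signs of the exponent are covered
by powers of two. -/
theorem add_rpow_le {t s : ℝ} (ht : 0 < t) (hs : |s| ≤ t / 2) (e : ℝ) :
    (t + s) ^ e ≤ 2 ^ |e| * t ^ e := by
  obtain ⟨h₁, h₂⟩ := abs_le.1 hs
  have h₃ : 0 < t + s := by linarith
  have hr : t + s = (t + s) / t * t := by field_simp
  rw [hr, Real.mul_rpow (by positivity) ht.le]
  gcongr
  rcases le_total 0 e with he | he
  · rw [abs_of_nonneg he]
    refine Real.rpow_le_rpow (by positivity) ?_ he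
    rw [div_le_iff₀ ht]
    linarith
  · rw [abs_of_nonpos he, Real.rpow_neg (by norm_num), ← Real.inv_rpow (by norm_num)]
    refine Real.rpow_le_rpow_of_nonpos (by norm_num) ?_ he
    rw [le_div_iff₀ ht]
    linarith

/-- On the slab, `|h₀| ≤ |h|² < t / 3`, so the weights at `z` and `z + h` are comparable, and `z +
h` stays in `(0, T)`. -/
theorem weightedNorm_shift_le {h : SpaceTime d} {ζ : R.A} (hζ : (ζ : ℝ) < γ)
    (hfm : AEStronglyMeasurable (fun z => (f z - g z) ζ) (volume.restrict (Ioo 0 T ×ˢ univ)))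
    (hper : ∀ t ∈ Ioo 0 T, ∀ (x : Fin d → ℝ) (k : Fin d → ℤ),
      (f (t, x + fun i => (k i : ℝ)) - g (t, x + fun i => (k i : ℝ))) ζ
        = (f (t, x) - g (t, x)) ζ) :
    weightedNorm (torusSlab d (3 * parNorm h ^ 2) (T - parNorm h ^ 2)) p (parWeight h η ζ ζ)
      (fun z => (f (z + h) - g (z + h)) ζ) ≤
        ((2 : ℝ≥0) ^ |(η - ζ) / 2| : ℝ≥0) * localDist γ η T p f g := by
  have hh := abs_fst_le_parNorm_sq h
  have hh' := abs_le.1 hh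
  have hsq : 0 ≤ parNorm h ^ 2 := sq_nonneg _
  let G : SpaceTime d → ℝ := fun z => ‖(f z - g z) ζ‖ / z.1 ^ ((η - ζ) / 2)
  have hG : AEStronglyMeasurable G (torusSlab d 0 T) :=
    ((hfm.mono_measure (torusSlab_le 0 T)).norm.aemeasurable.div
      (by fun_prop : Measurable fun z : SpaceTime d =>
        z.1 ^ ((η - ζ) / 2)).aemeasurable).aestronglyMeasurable
  have hshift := eLpNorm_shift_le G h (a := 3 * parNorm h ^ 2) (b := T - parNorm h ^ 2) p
    (by linarith) (by linarith) hG (fun t ht x k => by simp only [G, hper t ht x k])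
  have hsup : eLpNorm G p (torusSlab d 0 T) ≤ localDist γ η T p f g := le_iSup₂_of_le ζ hζ le_rfl
  refine le_trans ?_ (mul_le_mul_right (hshift.trans hsup) _)
  refine (weightedNorm_le_mul (E' := ℝ) (w' := fun _ => 1) (G := fun z => G (z + h))
    ((2 : ℝ≥0) ^ |(η - ζ) / 2|) ?_).trans ?_
  · refine ae_torusSlab fun z hz _ => ?_
    have hz₀ : 0 < z.1 := by linarith [hz.1]
    have hz₁ : 0 < z.1 + h.1 := by linarith [hz.1]
    rw [parWeight_self]
    refine ⟨by positivity, zero_le_one, ?_⟩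
    have hle := add_rpow_le hz₀ (hh.trans (by linarith [hz.1])) ((η - ζ) / 2)
    have h₁ := Real.rpow_pos_of_pos hz₀ ((η - ζ) / 2)
    have h₂ := Real.rpow_pos_of_pos hz₁ ((η - ζ) / 2)
    have hGz : ‖G (z + h)‖ = ‖(f (z + h) - g (z + h)) ζ‖ / (z.1 + h.1) ^ ((η - ζ) / 2) := by
      exact Real.norm_of_nonneg (div_nonneg (norm_nonneg _) h₂.le)
    rw [hGz, div_one, NNReal.coe_rpow, NNReal.coe_ofNat, ← mul_div_assoc, div_le_div_iff₀ h₁ h₂]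
    calc _ ≤ ‖(f (z + h) - g (z + h)) ζ‖ * (2 ^ |(η - ζ) / 2| * z.1 ^ ((η - ζ) / 2)) := by
          gcongr
      _ = _ := by ring
  · gcongr
    simp only [weightedNorm, div_one]
    exact (eLpNorm_norm _).le

theorem MemDSector.mem_below (hf : MemDSector M V γ η T p f) {z : SpaceTime d}
    (hz : z.1 ∈ Ioo 0 T) : f z ∈ V.below γ := fun ζ =>
  ⟨hf.2 z.1 hz z.2 ζ, hf.1.level_lt z.1 hz z.2 ζ⟩

theorem weightedNorm_le_translDist {h : SpaceTime d} (hh : parNorm h < 1) {ζ : R.A}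
    (hζ : (ζ : ℝ) < γ) :
    weightedNorm (torusSlab d (3 * parNorm h ^ 2) (T - parNorm h ^ 2)) p (parWeight h η γ ζ)
      (fun z => (f (z + h) - g (z + h) - M.Γ (z + h) z (f z) + M'.Γ (z + h) z (g z)) ζ) ≤
        translDist M M' γ η T p f g :=
  le_iSup₂_of_le ζ hζ (le_iSup₂_of_le h hh le_rfl)

theorem weightedNorm_le_translNorm {h : SpaceTime d} (hh : parNorm h < 1) {ζ : R.A}
    (hζ : (ζ : ℝ) < γ) :
    weightedNorm (torusSlab d (3 * parNorm h ^ 2) (T - parNorm h ^ 2)) p (parWeight h η γ ζ)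
      (fun z => (f (z + h) - M.Γ (z + h) z (f z)) ζ) ≤ translNorm M γ η T p f :=
  le_iSup₂_of_le ζ hζ (le_iSup₂_of_le h hh le_rfl)

end ModelledDistributions

/-! ### Bookkeeping for sums of terms with a common bound. -/

section TermBound

variable {X E : Type*} [MeasurableSpace X] [NormedAddCommGroup E] {μ : Measure X} {p : ℝ≥0∞}
  {w : X → ℝ} {B : ℝ≥0∞}

/-- `F` is measurable and its weighted norm is at most `c B`. -/
def TermBound (μ : Measure X) (p : ℝ≥0∞) (w : X → ℝ) (B : ℝ≥0∞) (c : ℝ≥0) (F : X → E) : Prop :=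
  AEStronglyMeasurable F μ ∧ weightedNorm μ p w F ≤ c * B

theorem TermBound.add {F G : X → E} {a b : ℝ≥0} (hF : TermBound μ p w B a F)
    (hG : TermBound μ p w B b G) (hw : Measurable w) (hw₀ : ∀ᵐ x ∂μ, 0 ≤ w x) :
    TermBound μ p w B ((lpSumConst p 2).toNNReal * (a + b)) (fun x => F x + G x) := by
  refine ⟨hF.1.add hG.1, (weightedNorm_add_le hF.1 hG.1 hw.aemeasurable hw₀ hF.2 hG.2).trans_eq ?_⟩
  rw [ENNReal.coe_mul, ENNReal.coe_toNNReal (lpSumConst_ne_top _ _), ENNReal.coe_add]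
  ring

theorem TermBound.sum {ι : Type*} (s : Finset ι) {F : ι → X → E} {c : ℝ≥0}
    (hF : ∀ i ∈ s, TermBound μ p w B c (F i)) (hw : Measurable w) (hw₀ : ∀ᵐ x ∂μ, 0 ≤ w x) :
    TermBound μ p w B ((lpSumConst p s.card).toNNReal * (s.card * c))
      (fun x => ∑ i ∈ s, F i x) := by
  refine ⟨Finset.aestronglyMeasurable_fun_sum s fun i hi => (hF i hi).1,
    (weightedNorm_sum_le s (fun i hi => (hF i hi).1) hw.aemeasurable hw₀).trans ?_⟩
  rw [ENNReal.coe_mul, ENNReal.coe_toNNReal (lpSumConst_ne_top _ _), ENNReal.coe_mul,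
    ENNReal.coe_natCast, mul_assoc, mul_assoc]
  gcongr
  rw [← nsmul_eq_mul]
  exact Finset.sum_le_card_nsmul _ _ _ fun i hi => (hF i hi).2

end TermBound

section SectorFun

variable {d r : ℕ} {R : RegularityStructure.{u}} {α γ : ℝ} {V : Sector R α}
  {μ : Measure (SpaceTime d)} {u v : SpaceTime d → R.Space}

/-- Measurable functions with values in `V_{<γ}`. -/
def IsSectorFun (V : Sector R α) (γ : ℝ) (μ : Measure (SpaceTime d)) (u : SpaceTime d → R.Space) :
    Prop :=
  (∀ ζ, AEStronglyMeasurable (fun z => u z ζ) μ) ∧ ∀ᵐ z ∂μ, u z ∈ V.below γ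

namespace IsSectorFun

theorem add (hu : IsSectorFun V γ μ u) (hv : IsSectorFun V γ μ v) :
    IsSectorFun V γ μ fun z => u z + v z := by
  refine ⟨fun ζ => ?_, ?_⟩
  · simp only [DFinsupp.add_apply]
    exact (hu.1 ζ).add (hv.1 ζ)
  · filter_upwards [hu.2, hv.2] with z h₁ h₂ using add_mem h₁ h₂

theorem sub (hu : IsSectorFun V γ μ u) (hv : IsSectorFun V γ μ v) :
    IsSectorFun V γ μ fun z => u z - v z := by
  refine ⟨fun ζ => ?_, ?_⟩
  · simp only [DFinsupp.sub_apply]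
    exact (hu.1 ζ).sub (hv.1 ζ)
  · filter_upwards [hu.2, hv.2] with z h₁ h₂ using sub_mem h₁ h₂

theorem single (hu : IsSectorFun V γ μ u) {ζ : R.A} (hζ : (ζ : ℝ) < γ) :
    IsSectorFun V γ μ fun z => DFinsupp.single ζ (u z ζ) := by
  refine ⟨fun ν => ?_, ?_⟩
  · rcases eq_or_ne ν ζ with rfl | h
    · simpa only [DFinsupp.single_eq_same] using hu.1 ν
    · simp only [DFinsupp.single_eq_of_ne h]
      exact aestronglyMeasurable_const
  · filter_upwards [hu.2] with z h using Sector.single_mem_below (h ζ).1 hζ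

theorem apply_Γ (hu : IsSectorFun V γ μ u) (M : Model d r R) (h : SpaceTime d) :
    IsSectorFun V γ μ fun z => M.Γ (z + h) z (u z) :=
  ⟨fun ν => M.aestronglyMeasurable_Γ h hu.1 hu.2 ν,
    hu.2.mono fun _ hz => Sector.apply_mem_below (M.mem_G _ _) hz⟩

theorem apply_Γ_sub (hu : IsSectorFun V γ μ u) (M M' : Model d r R) (h : SpaceTime d) :
    IsSectorFun V γ μ fun z =>
      ((M.Γ (z + h) z : R.Space →ₗ[ℝ] R.Space) - (M'.Γ (z + h) z : R.Space →ₗ[ℝ] R.Space)) (u z) :=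
  (hu.apply_Γ M h).sub (hu.apply_Γ M' h)

end IsSectorFun

variable {M : Model d r R} {η T : ℝ} {p : ℝ≥0∞} {f : SpaceTime d → R.Space}

theorem MemDSector.isSectorFun (hf : MemDSector M V γ η T p f) {a b : ℝ} (ha : 0 ≤ a)
    (hb : b ≤ T) : IsSectorFun V γ (torusSlab d a b) f :=
  ⟨fun ζ => (hf.1.measurable ζ).mono_measure ((torusSlab_mono ha hb).trans (torusSlab_le 0 T)),
    ae_torusSlab fun _ hz _ => hf.mem_below ⟨ha.trans_lt hz.1, hz.2.trans_le hb⟩⟩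

theorem MemDSector.isSectorFun_shift (hf : MemDSector M V γ η T p f) {h : SpaceTime d} {a b : ℝ}
    (ha : 0 ≤ a + h.1) (hb : b + h.1 ≤ T) :
    IsSectorFun V γ (torusSlab d a b) fun z => f (z + h) :=
  ⟨fun ζ => aestronglyMeasurable_shift (G := fun z => f z ζ) h ha hb (hf.1.measurable ζ),
    ae_torusSlab fun z hz _ => hf.mem_below
      ⟨by simpa using by linarith [hz.1], by simpa using by linarith [hz.2]⟩⟩

end SectorFun

/-- The right-hand side of the estimate of the distance between two products. -/
def productBound (N N' Δ l₁ l₂ D₁ D₂ F₁ F₂ G₁ G₂ : ℝ≥0∞) : ℝ≥0∞ :=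
  N ^ 2 * l₁ * F₂ + Δ * ((N + N') * G₁ * F₂ + G₂ * F₁) + D₁ * F₂ + N * F₁ * D₂
    + (1 + N' ^ 2) * G₁ * l₂ + N' * l₁ * G₂

/-- The bound expands into exactly these nine monomials. They are the sizes of the elementary
products in the increment: five from the telescoped part and four from the high pairs. -/
theorem terms_le_productBound (N N' Δ l₁ l₂ D₁ D₂ F₁ F₂ G₁ G₂ : ℝ≥0∞) {B : ℝ≥0∞}
    (hB : B = productBound N N' Δ l₁ l₂ D₁ D₂ F₁ F₂ G₁ G₂) :
    D₁ * F₂ ≤ B ∧ G₁ * l₂ ≤ B ∧ N * F₁ * D₂ ≤ B ∧ Δ * F₁ * G₂ ≤ B ∧ N' * l₁ * G₂ ≤ B ∧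
      N * l₁ * (N * F₂) ≤ B ∧ Δ * G₁ * (N * F₂) ≤ B ∧ N' * G₁ * (Δ * F₂) ≤ B ∧
      N' * G₁ * (N' * l₂) ≤ B := by
  have h : B = D₁ * F₂ + G₁ * l₂ + N * F₁ * D₂ + Δ * F₁ * G₂ + N' * l₁ * G₂
      + N * l₁ * (N * F₂) + Δ * G₁ * (N * F₂) + N' * G₁ * (Δ * F₂) + N' * G₁ * (N' * l₂) := by
    rw [hB, productBound]
    ring
  rw [h]
  refine ⟨?_, ?_, ?_, ?_, ?_, ?_, ?_, ?_, ?_⟩ <;>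
  repeat first
    | exact le_rfl
    | exact le_add_left le_rfl
    | refine le_add_right ?_

/-! ### Estimates of the product: single terms, local part, translation part. -/

namespace SectorProduct

variable {d r : ℕ} {R : RegularityStructure.{u}} {α₁ α₂ : ℝ} {V₁ : Sector R α₁} {V₂ : Sector R α₂}
  (P : SectorProduct V₁ V₂)

/-- The exponents may depend on the level, so that one statement covers increments (constant `γ_i`),
transported values (`s = ζ`) and high pairs (a fixed pair of levels). The factor `a` absorbs
constants in the comparison with the common bound. -/
theorem exists_parWeight_mul_le (γ₁ γ₂ η₁ η₂ γ : ℝ) (p₁ p₂ p : ℝ≥0∞)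
    [ENNReal.HolderTriple p₁ p₂ p] :
    ∃ C : ℝ≥0, ∀ (μ : Measure (SpaceTime d)) (h : SpaceTime d) (u v : SpaceTime d → R.Space)
      (s₁ s₂ : R.A → ℝ) (ν : R.A) (A B E : ℝ≥0∞), 0 < parNorm h → (∀ᵐ z ∂μ, parNorm h ^ 2 ≤ z.1) →
      IsSectorFun V₁ γ₁ μ u → IsSectorFun V₂ γ₂ μ v →
      (∀ ζ₁ ∈ R.levels α₁ γ₁, ∀ ζ₂ ∈ R.levels α₂ γ₂, γ ≤ s₁ ζ₁ + s₂ ζ₂) →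
      (∀ ζ ∈ R.levels α₁ γ₁, weightedNorm μ p₁ (parWeight h η₁ (s₁ ζ) ζ) (fun z => u z ζ) ≤ A) →
      (∀ ζ ∈ R.levels α₂ γ₂, weightedNorm μ p₂ (parWeight h η₂ (s₂ ζ) ζ) (fun z => v z ζ) ≤ B) →
      ∀ a : ℝ≥0, A * B ≤ a * E →
      TermBound μ p (parWeight h (η₁ + η₂) γ ν) E (C * a) (fun z => P.mul (u z) (v z) ν) := by
  obtain ⟨C, hC⟩ := P.exists_weightedNorm_mul_le γ₁ γ₂ p₁ p₂ p
  refine ⟨C, fun μ h u v s₁ s₂ ν A B E hh hμ hu hv hs hA hB a ha =>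
    ⟨P.aestronglyMeasurable_mul hu.1 hu.2 hv.1 hv.2 ν, ?_⟩⟩
  refine (hC μ u v (fun ζ => parWeight h η₁ (s₁ ζ) ζ) (fun ζ => parWeight h η₂ (s₂ ζ) ζ) _ ν A B
    hu.1 hu.2 hv.1 hv.2 (fun ζ => measurable_parWeight _ _ _ _)
    (fun ζ => measurable_parWeight _ _ _ _) ?_ ?_ hA hB).trans ?_
  · filter_upwards [hμ] with z hz q hq hν
    have hz₀ : 0 < z.1 := (pow_pos hh 2).trans_le hz
    obtain ⟨h₁, h₂⟩ := Finset.mem_product.1 hq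
    refine ⟨parWeight_pos hh hz₀ _ _ _, parWeight_pos hh hz₀ _ _ _, ?_⟩
    rw [parWeight_mul hh hz₀, hν]
    exact parWeight_antitone hh hz _ _ (hs _ h₁ _ h₂)
  · filter_upwards [hμ] with z hz
    exact (parWeight_pos hh ((pow_pos hh 2).trans_le hz) _ _ _).le
  · rw [ENNReal.coe_mul, mul_assoc]
    gcongr

end SectorProduct

namespace SectorProduct

variable {d r : ℕ} {R : RegularityStructure.{u}} {α₁ α₂ : ℝ} {V₁ : Sector R α₁} {V₂ : Sector R α₂}
  (P : SectorProduct V₁ V₂)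

theorem exists_localDist_mulFun_le (γ₁ γ₂ η₁ η₂ γ : ℝ) (p₁ p₂ p : ℝ≥0∞)
    [ENNReal.HolderTriple p₁ p₂ p] :
    ∃ C : ℝ≥0, ∀ (T : ℝ) (M M' : Model d r R) (f₁ f₂ g₁ g₂ : SpaceTime d → R.Space),
      MemDSector M V₁ γ₁ η₁ T p₁ f₁ → MemDSector M V₂ γ₂ η₂ T p₂ f₂ →
      MemDSector M' V₁ γ₁ η₁ T p₁ g₁ → MemDSector M' V₂ γ₂ η₂ T p₂ g₂ →
      localDist γ (η₁ + η₂) T p (P.mulFun γ f₁ f₂) (P.mulFun γ g₁ g₂) ≤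
        C * (localDist γ₁ η₁ T p₁ f₁ g₁ * localDist γ₂ η₂ T p₂ f₂ 0 +
          localDist γ₁ η₁ T p₁ g₁ 0 * localDist γ₂ η₂ T p₂ f₂ g₂) := by
  obtain ⟨C, hC⟩ := P.exists_weightedNorm_mul_le γ₁ γ₂ p₁ p₂ p
  refine ⟨(lpSumConst p 2).toNNReal * C, fun T M M' f₁ f₂ g₁ g₂ hf₁ hf₂ hg₁ hg₂ =>
    iSup₂_le fun ν hν => ?_⟩
  have sf₁ := hf₁.isSectorFun le_rfl le_rfl
  have sf₂ := hf₂.isSectorFun le_rfl le_rfl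
  have sg₁ := hg₁.isSectorFun le_rfl le_rfl
  have sg₂ := hg₂.isSectorFun le_rfl le_rfl
  let w : ℝ → ℝ → SpaceTime d → ℝ := fun η ζ z => z.1 ^ ((η - ζ) / 2)
  have hwm : ∀ η ζ, Measurable (w η ζ) := fun η ζ => by fun_prop
  have hpos : ∀ᵐ z ∂torusSlab d 0 T, 0 < z.1 := ae_torusSlab fun z hz _ => hz.1
  have hmul : ∀ {u v : SpaceTime d → R.Space} {A B : ℝ≥0∞}, IsSectorFun V₁ γ₁ (torusSlab d 0 T) u →
      IsSectorFun V₂ γ₂ (torusSlab d 0 T) v →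
      (∀ ζ ∈ R.levels α₁ γ₁, weightedNorm (torusSlab d 0 T) p₁ (w η₁ ζ) (fun z => u z ζ) ≤ A) →
      (∀ ζ ∈ R.levels α₂ γ₂, weightedNorm (torusSlab d 0 T) p₂ (w η₂ ζ) (fun z => v z ζ) ≤ B) →
      weightedNorm (torusSlab d 0 T) p (w (η₁ + η₂) ν) (fun z => P.mul (u z) (v z) ν) ≤
        C * (A * B) := by
    intro u v A B hu hv hA hB
    refine hC _ u v (fun ζ => w η₁ ζ) (fun ζ => w η₂ ζ) _ ν A B hu.1 hu.2 hv.1 hv.2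
      (fun ζ => hwm _ _) (fun ζ => hwm _ _) ?_ (hpos.mono fun z hz => by positivity) hA hB
    filter_upwards [hpos] with z hz q _ hq
    refine ⟨by positivity, by positivity, le_of_eq ?_⟩
    simp only [w]
    rw [← Real.rpow_add hz, ← hq]
    ring_nf
  have hld : ∀ {γ' η' : ℝ} {p' : ℝ≥0∞} {f g : SpaceTime d → R.Space} {ζ : R.A}, (ζ : ℝ) < γ' →
      weightedNorm (torusSlab d 0 T) p' (w η' ζ) (fun z => (f z - g z) ζ) ≤
        localDist γ' η' T p' f g := fun {_ _ _ _ _ ζ} hζ => le_iSup₂_of_le ζ hζ le_rfl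
  have hld₀ : ∀ {γ' η' : ℝ} {p' : ℝ≥0∞} {f : SpaceTime d → R.Space} {ζ : R.A}, (ζ : ℝ) < γ' →
      weightedNorm (torusSlab d 0 T) p' (w η' ζ) (fun z => f z ζ) ≤
        localDist γ' η' T p' f 0 := fun {_ _ _ f _} hζ => by
    simpa only [Pi.zero_apply, sub_zero] using hld (f := f) (g := 0) hζ
  -- The local part compares values at one point, so the ordinary Leibniz splitting is enough and
  -- `Γ` does not enter.
  have hsum : ∀ z, (P.mulFun γ f₁ f₂ z - P.mulFun γ g₁ g₂ z) ν =
      P.mul (f₁ z - g₁ z) (f₂ z) ν + P.mul (g₁ z) (f₂ z - g₂ z) ν := fun z => by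
    simp only [mulFun, DFinsupp.sub_apply, trunc_apply, if_pos hν, map_sub, LinearMap.sub_apply]
    abel
  have h₁ := hmul (sf₁.sub sg₁) sf₂ (fun ζ hζ => hld (mem_levels.1 hζ).2)
    (fun ζ hζ => hld₀ (mem_levels.1 hζ).2)
  have h₂ := hmul sg₁ (sf₂.sub sg₂) (fun ζ hζ => hld₀ (mem_levels.1 hζ).2)
    (fun ζ hζ => hld (mem_levels.1 hζ).2)
  change weightedNorm (torusSlab d 0 T) p (w (η₁ + η₂) ν)
    (fun z => (P.mulFun γ f₁ f₂ z - P.mulFun γ g₁ g₂ z) ν) ≤ _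
  simp only [hsum]
  refine (weightedNorm_add_le
    (P.aestronglyMeasurable_mul (sf₁.sub sg₁).1 (sf₁.sub sg₁).2 sf₂.1 sf₂.2 ν)
    (P.aestronglyMeasurable_mul sg₁.1 sg₁.2 (sf₂.sub sg₂).1 (sf₂.sub sg₂).2 ν)
    (hwm _ _).aemeasurable (hpos.mono fun z hz => by positivity) h₁ h₂).trans_eq ?_
  rw [ENNReal.coe_mul, ENNReal.coe_toNNReal (lpSumConst_ne_top _ _)]
  ring

/-- The constant in the comparison of the weights at `z` and at `z + h`. -/
def shiftConst (S : Finset R.A) (η : ℝ) : ℝ≥0 := ∑ ζ ∈ S, (2 : ℝ≥0) ^ |(η - ζ) / 2|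

theorem le_shiftConst {S : Finset R.A} (η : ℝ) {ζ : R.A} (hζ : ζ ∈ S) :
    (2 : ℝ≥0) ^ |(η - ζ) / 2| ≤ shiftConst S η :=
  Finset.single_le_sum (f := fun ζ : R.A => (2 : ℝ≥0) ^ |(η - ζ) / 2|) (fun _ _ => zero_le) hζ

/-- The constant in the estimate of a sum over the levels of a sector. -/
def levelsConst (S : Finset R.A) (p : ℝ≥0∞) : ℝ≥0 := (lpSumConst p S.card).toNNReal * S.card

theorem coe_levelsConst (S : Finset R.A) (p : ℝ≥0∞) :
    (levelsConst S p : ℝ≥0∞) = lpSumConst p S.card * S.card := by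
  rw [levelsConst, ENNReal.coe_mul, ENNReal.coe_toNNReal (lpSumConst_ne_top _ _),
    ENNReal.coe_natCast]

theorem exists_translDist_mulFun_le (γ₁ γ₂ η₁ η₂ γ : ℝ) (p₁ p₂ p : ℝ≥0∞)
    [ENNReal.HolderTriple p₁ p₂ p] (hγ : γ = min (γ₁ + α₂) (γ₂ + α₁)) (hP : P.IsRegular γ) :
    ∃ C : ℝ≥0, ∀ (T : ℝ) (M M' : Model d r R) (f₁ f₂ g₁ g₂ : SpaceTime d → R.Space),
      MemDSector M V₁ γ₁ η₁ T p₁ f₁ → MemDSector M V₂ γ₂ η₂ T p₂ f₂ →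
      MemDSector M' V₁ γ₁ η₁ T p₁ g₁ → MemDSector M' V₂ γ₂ η₂ T p₂ g₂ →
      translDist M M' γ (η₁ + η₂) T p (P.mulFun γ f₁ f₂) (P.mulFun γ g₁ g₂) ≤
        C * productBound (M.normΓ (max γ₁ γ₂) T) (M'.normΓ (max γ₁ γ₂) T)
          (M.distΓ M' (max γ₁ γ₂) T) (localDist γ₁ η₁ T p₁ f₁ g₁) (localDist γ₂ η₂ T p₂ f₂ g₂)
          (dDist M M' γ₁ η₁ T p₁ f₁ g₁) (dDist M M' γ₂ η₂ T p₂ f₂ g₂)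
          (dNorm M γ₁ η₁ T p₁ f₁) (dNorm M γ₂ η₂ T p₂ f₂)
          (dNorm M' γ₁ η₁ T p₁ g₁) (dNorm M' γ₂ η₂ T p₂ g₂) := by
  obtain ⟨C, hC⟩ := P.exists_parWeight_mul_le (d := d) γ₁ γ₂ η₁ η₂ γ p₁ p₂ p
  set S₁ := R.levels α₁ γ₁ with hS₁
  set S₂ := R.levels α₂ γ₂ with hS₂
  let D : ℝ≥0 := (lpSumConst p 2).toNNReal
  let D₁ : ℝ≥0 := (lpSumConst p₁ 2).toNNReal
  let H := P.highPairs γ₁ γ₂ γ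
  let sc := shiftConst S₂ η₂
  let lc := levelsConst S₁ p₁
  -- The nesting mirrors the successive additions of terms: `D` is the cost of each in `L^p`, `sc`
  -- of a shift of the second factor, `lc` of a sum over levels in `Γ f₁`.
  refine ⟨D * (D * (D * (D * (C * sc + C * sc) + C * lc) + C * (D₁ * lc * 2)) +
    (lpSumConst p H.card).toNNReal * (H.card * (D * (D * (D * (C * 1 + C * 1) + C * 1) + C * 1)))),
    fun T M M' f₁ f₂ g₁ g₂ hf₁ hf₂ hg₁ hg₂ =>
    iSup₂_le fun ν hν => iSup₂_le fun h hh => ?_⟩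
  set c := max γ₁ γ₂
  set B := productBound _ _ _ _ _ _ _ _ _ _ _ with hB
  rcases (parNorm_nonneg h).eq_or_lt with h₀ | h₀
  -- For `|h| = 0` the weight vanishes since `ν < γ`, and division by zero makes the integrand zero.
  · rw [← h₀, Real.zero_rpow (sub_pos.2 hν).ne']
    simp
  set μ := torusSlab d (3 * parNorm h ^ 2) (T - parNorm h ^ 2) with hμ
  have hh₁ := abs_le.1 (abs_fst_le_parNorm_sq h)
  have hsq : 0 < parNorm h ^ 2 := pow_pos h₀ 2
  have hμt : ∀ᵐ z ∂μ, parNorm h ^ 2 ≤ z.1 := ae_torusSlab fun z hz _ => by linarith [hz.1]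
  have hμ₀ : ∀ᵐ z ∂μ, 0 < z.1 := hμt.mono fun z hz => hsq.trans_le hz
  have hγ₁ : ∀ {ζ : R.A}, ζ ∈ S₁ → (ζ : ℝ) < γ₁ := fun hζ => (mem_levels.1 hζ).2
  have hγ₂ : ∀ {ζ : R.A}, ζ ∈ S₂ → (ζ : ℝ) < γ₂ := fun hζ => (mem_levels.1 hζ).2
  have hγ₁' : γ ≤ γ₁ + α₂ := hγ ▸ min_le_left _ _
  have hγ₂' : γ ≤ γ₂ + α₁ := hγ ▸ min_le_right _ _
  have sf₁ : IsSectorFun V₁ γ₁ μ f₁ := hf₁.isSectorFun (by positivity) (by linarith)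
  have sf₂ : IsSectorFun V₂ γ₂ μ f₂ := hf₂.isSectorFun (by positivity) (by linarith)
  have sg₁ : IsSectorFun V₁ γ₁ μ g₁ := hg₁.isSectorFun (by positivity) (by linarith)
  have sg₂ : IsSectorFun V₂ γ₂ μ g₂ := hg₂.isSectorFun (by positivity) (by linarith)
  have sF₁ : IsSectorFun V₁ γ₁ μ fun z => f₁ (z + h) :=
    hf₁.isSectorFun_shift (by linarith) (by linarith)
  have sF₂ : IsSectorFun V₂ γ₂ μ fun z => f₂ (z + h) :=
    hf₂.isSectorFun_shift (by linarith) (by linarith)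
  have sG₁ : IsSectorFun V₁ γ₁ μ fun z => g₁ (z + h) :=
    hg₁.isSectorFun_shift (by linarith) (by linarith)
  have sG₂ : IsSectorFun V₂ γ₂ μ fun z => g₂ (z + h) :=
    hg₂.isSectorFun_shift (by linarith) (by linarith)
  have tΓ := M.isTransport (c := c) T h₀ hh
  have tΓ' := M'.isTransport (c := c) T h₀ hh
  have tΔ := M.isTransport_sub (c := c) M' T h₀ hh
  have cN := ENNReal.coe_toNNReal (M.normΓ_ne_top (c := c) T)
  have cN' := ENNReal.coe_toNNReal (M'.normΓ_ne_top (c := c) T)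
  have cΔ := ENNReal.coe_toNNReal (M.distΓ_ne_top M' (c := c) T)
  have hc₁ : γ₁ ≤ c := le_max_left _ _
  have hc₂ : γ₂ ≤ c := le_max_right _ _
  obtain ⟨b₁, b₂, b₃, b₄, b₅, b₆, b₇, b₈, b₉⟩ := terms_le_productBound _ _ _ _ _ _ _ _ _ _ _ hB
  have hld₀ : ∀ {γ' η' : ℝ} {p' : ℝ≥0∞} {f : SpaceTime d → R.Space} {M : Model d r R} {ζ : R.A},
      (ζ : ℝ) < γ' → weightedNorm μ p' (parWeight h η' ζ ζ) (fun z => f z ζ) ≤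
        dNorm M γ' η' T p' f := fun {γ' η' p' f M ζ} hζ => by
    have := weightedNorm_le_localDist (T := T) (η := η') (p := p') (f := f) (g := 0) h hζ
    simp only [Pi.zero_apply, sub_zero] at this
    exact this.trans le_self_add
  have hshift : ∀ ζ ∈ S₂, weightedNorm μ p₂ (parWeight h η₂ ζ ζ) (fun z => f₂ (z + h) ζ) ≤
      sc * dNorm M γ₂ η₂ T p₂ f₂ := fun ζ hζ => by
    have := weightedNorm_shift_le (T := T) (η := η₂) (p := p₂) (f := f₂) (g := 0) (h := h) (hγ₂ hζ)
      (by simpa using hf₂.1.measurable ζ) (fun t ht x k => by simp [hf₂.1.periodic t ht x k])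
    simp only [Pi.zero_apply, sub_zero] at this
    refine this.trans (mul_le_mul' ?_ le_self_add)
    exact_mod_cast le_shiftConst η₂ hζ
  have hshift' : ∀ ζ ∈ S₂, weightedNorm μ p₂ (parWeight h η₂ ζ ζ)
      (fun z => (f₂ (z + h) - g₂ (z + h)) ζ) ≤ sc * localDist γ₂ η₂ T p₂ f₂ g₂ := fun ζ hζ => by
    refine (weightedNorm_shift_le (T := T) (hγ₂ hζ)
      ((hf₂.1.measurable ζ).sub (hg₂.1.measurable ζ)) (fun t ht x k => by
        rw [hf₂.1.periodic t ht x k, hg₂.1.periodic t ht x k])).trans (mul_le_mul' ?_ le_rfl)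
    exact_mod_cast le_shiftConst η₂ hζ
  -- In each of the four main terms, one factor is an increment with exponent `γ_i`; the other has
  -- its own level as exponent, which is at least the regularity of its sector.
  have t₁ := hC μ h (fun z => f₁ (z + h) - g₁ (z + h) - M.Γ (z + h) z (f₁ z) + M'.Γ (z + h) z (g₁ z))
    (fun z => f₂ (z + h)) (fun _ => γ₁) (fun ζ => ζ) ν _ _ B h₀ hμt
    (((sF₁.sub sG₁).sub (sf₁.apply_Γ M h)).add (sg₁.apply_Γ M' h)) sF₂
    (fun ζ₁ _ ζ₂ h₂ => by linarith [(mem_levels.1 h₂).1])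
    (fun ζ hζ => (weightedNorm_le_translDist hh (hγ₁ hζ)).trans le_add_self) hshift sc
    (by rw [mul_left_comm]; gcongr; exact b₁)
  have t₂ := hC μ h (fun z => g₁ (z + h) - M'.Γ (z + h) z (g₁ z))
    (fun z => f₂ (z + h) - g₂ (z + h)) (fun _ => γ₁) (fun ζ => ζ) ν _ _ B h₀ hμt
    (sG₁.sub (sg₁.apply_Γ M' h)) (sF₂.sub sG₂)
    (fun ζ₁ _ ζ₂ h₂ => by linarith [(mem_levels.1 h₂).1])
    (fun ζ hζ => (weightedNorm_le_translNorm hh (hγ₁ hζ)).trans le_add_self) hshift' sc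
    (by rw [mul_left_comm]; gcongr; exact b₂)
  have t₃ := hC μ h (fun z => M.Γ (z + h) z (f₁ z))
    (fun z => f₂ (z + h) - g₂ (z + h) - M.Γ (z + h) z (f₂ z) + M'.Γ (z + h) z (g₂ z))
    (fun ζ => ζ) (fun _ => γ₂) ν _ _ B h₀ hμt (sf₁.apply_Γ M h)
    (((sF₂.sub sG₂).sub (sf₂.apply_Γ M h)).add (sg₂.apply_Γ M' h))
    (fun ζ₁ h₁ ζ₂ _ => by linarith [(mem_levels.1 h₁).1])
    (fun ζ _ => tΓ.weightedNorm_le h₀ hμt hc₁ sf₁.2 ζ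
      (fun ζ' => M.aestronglyMeasurable_Γ_single h ζ' ζ (sf₁.1 ζ'))
      fun ζ' hζ' => hld₀ (M := M) (hγ₁ hζ'))
    (fun ζ hζ => (weightedNorm_le_translDist hh (hγ₂ hζ)).trans le_add_self) lc
    (by rw [coe_levelsConst, cN, mul_assoc]; gcongr; exact b₃)
  have t₄ := hC μ h (fun z => ((M.Γ (z + h) z : R.Space →ₗ[ℝ] R.Space) - M'.Γ (z + h) z) (f₁ z)
      + M'.Γ (z + h) z (f₁ z - g₁ z))
    (fun z => g₂ (z + h) - M'.Γ (z + h) z (g₂ z)) (fun ζ => ζ) (fun _ => γ₂) ν _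
    (dNorm M' γ₂ η₂ T p₂ g₂) B h₀ hμt
    ((sf₁.apply_Γ_sub M M' h).add ((sf₁.sub sg₁).apply_Γ M' h)) (sG₂.sub (sg₂.apply_Γ M' h))
    (fun ζ₁ h₁ ζ₂ _ => by linarith [(mem_levels.1 h₁).1])
    (fun ζ _ => weightedNorm_add_le ((sf₁.apply_Γ_sub M M' h).1 ζ)
      (((sf₁.sub sg₁).apply_Γ M' h).1 ζ) (measurable_parWeight _ _ _ _).aemeasurable
      (hμ₀.mono fun z hz => (parWeight_pos h₀ hz _ _ _).le)
      (tΔ.weightedNorm_le h₀ hμt hc₁ sf₁.2 ζ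
        (fun ζ' => (M.aestronglyMeasurable_Γ_single h ζ' ζ (sf₁.1 ζ')).sub
          (M'.aestronglyMeasurable_Γ_single h ζ' ζ (sf₁.1 ζ')))
        fun ζ' hζ' => hld₀ (M := M) (hγ₁ hζ'))
      (tΓ'.weightedNorm_le h₀ hμt hc₁ (sf₁.sub sg₁).2 ζ
        (fun ζ' => M'.aestronglyMeasurable_Γ_single h ζ' ζ ((sf₁.sub sg₁).1 ζ'))
        fun ζ' hζ' => weightedNorm_le_localDist h (hγ₁ hζ')))
    -- The first factor is a sum of two pieces, from `Γ - Γ'` and from `f₁ - g₁`: `D₁` is the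
    -- triangle constant in `L^{p₁}`, and `2` counts the two monomials.
    (fun ζ hζ => (weightedNorm_le_translNorm hh (hγ₂ hζ)).trans le_add_self) (D₁ * lc * 2) (by
      rw [ENNReal.coe_mul, ENNReal.coe_mul, cΔ, cN', ← coe_levelsConst,
        ENNReal.coe_toNNReal (lpSumConst_ne_top _ _), ENNReal.coe_ofNat]
      calc _ = lpSumConst p₁ 2 * lc *
            (M.distΓ M' c T * dNorm M γ₁ η₁ T p₁ f₁ * dNorm M' γ₂ η₂ T p₂ g₂ +
              M'.normΓ c T * localDist γ₁ η₁ T p₁ f₁ g₁ * dNorm M' γ₂ η₂ T p₂ g₂) := by ring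
        _ ≤ lpSumConst p₁ 2 * lc * (B + B) := mul_le_mul' le_rfl (add_le_add b₄ b₅)
        _ = _ := by ring)
  have hw := measurable_parWeight h (η₁ + η₂) γ ν
  have hw₀ : ∀ᵐ z ∂μ, 0 ≤ parWeight h (η₁ + η₂) γ ν z :=
    hμ₀.mono fun z hz => (parWeight_pos h₀ hz _ _ _).le
  have hH : ∀ q ∈ H, TermBound μ p (parWeight h (η₁ + η₂) γ ν) B
      (D * (D * (D * (C * 1 + C * 1) + C * 1) + C * 1)) (fun z =>
        P.mul (M.Γ (z + h) z (DFinsupp.single q.1 ((f₁ z - g₁ z) q.1)))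
          (M.Γ (z + h) z (DFinsupp.single q.2 (f₂ z q.2))) ν
        + P.mul (((M.Γ (z + h) z : R.Space →ₗ[ℝ] R.Space) - M'.Γ (z + h) z)
              (DFinsupp.single q.1 (g₁ z q.1)))
            (M.Γ (z + h) z (DFinsupp.single q.2 (f₂ z q.2))) ν
        + P.mul (M'.Γ (z + h) z (DFinsupp.single q.1 (g₁ z q.1)))
            (((M.Γ (z + h) z : R.Space →ₗ[ℝ] R.Space) - M'.Γ (z + h) z)
              (DFinsupp.single q.2 (f₂ z q.2))) ν
        + P.mul (M'.Γ (z + h) z (DFinsupp.single q.1 (g₁ z q.1)))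
            (M'.Γ (z + h) z (DFinsupp.single q.2 ((f₂ z - g₂ z) q.2))) ν) := by
    intro q hq
    obtain ⟨⟨hq₁, hq₂⟩, hq₁₂⟩ := mem_highPairs.1 hq
    have l₁ := hγ₁ hq₁
    have l₂ := hγ₂ hq₂
    have l₁' := l₁.trans_le hc₁
    have l₂' := l₂.trans_le hc₂
    -- For a high pair no increment is needed: the exponents `q.1` and `q.2` already sum to at least
    -- `γ`.
    have e₁ := hC μ h (fun z => M.Γ (z + h) z (DFinsupp.single q.1 ((f₁ z - g₁ z) q.1)))
      (fun z => M.Γ (z + h) z (DFinsupp.single q.2 (f₂ z q.2)))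
      (fun _ => q.1) (fun _ => q.2) ν _ _ B h₀ hμt
      (((sf₁.sub sg₁).single l₁).apply_Γ M h) ((sf₂.single l₂).apply_Γ M h)
      (fun _ _ _ _ => hq₁₂)
      (fun ζ _ => (tΓ.weightedNorm_single_le h₀ hμ₀ l₁' _ ζ).trans
        (mul_le_mul' cN.le (weightedNorm_le_localDist h l₁)))
      (fun ζ _ => (tΓ.weightedNorm_single_le h₀ hμ₀ l₂' _ ζ).trans
        (mul_le_mul' cN.le (hld₀ (M := M) l₂))) 1 (by rw [ENNReal.coe_one, one_mul]; exact b₆)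
    have e₂ := hC μ h (fun z => ((M.Γ (z + h) z : R.Space →ₗ[ℝ] R.Space) - M'.Γ (z + h) z)
        (DFinsupp.single q.1 (g₁ z q.1)))
      (fun z => M.Γ (z + h) z (DFinsupp.single q.2 (f₂ z q.2)))
      (fun _ => q.1) (fun _ => q.2) ν _ _ B h₀ hμt
      ((sg₁.single l₁).apply_Γ_sub M M' h) ((sf₂.single l₂).apply_Γ M h)
      (fun _ _ _ _ => hq₁₂)
      (fun ζ _ => (tΔ.weightedNorm_single_le h₀ hμ₀ l₁' _ ζ).trans
        (mul_le_mul' cΔ.le (hld₀ (M := M') l₁)))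
      (fun ζ _ => (tΓ.weightedNorm_single_le h₀ hμ₀ l₂' _ ζ).trans
        (mul_le_mul' cN.le (hld₀ (M := M) l₂))) 1 (by rw [ENNReal.coe_one, one_mul]; exact b₇)
    have e₃ := hC μ h (fun z => M'.Γ (z + h) z (DFinsupp.single q.1 (g₁ z q.1)))
      (fun z => ((M.Γ (z + h) z : R.Space →ₗ[ℝ] R.Space) - M'.Γ (z + h) z)
        (DFinsupp.single q.2 (f₂ z q.2)))
      (fun _ => q.1) (fun _ => q.2) ν _ _ B h₀ hμt
      ((sg₁.single l₁).apply_Γ M' h) ((sf₂.single l₂).apply_Γ_sub M M' h)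
      (fun _ _ _ _ => hq₁₂)
      (fun ζ _ => (tΓ'.weightedNorm_single_le h₀ hμ₀ l₁' _ ζ).trans
        (mul_le_mul' cN'.le (hld₀ (M := M') l₁)))
      (fun ζ _ => (tΔ.weightedNorm_single_le h₀ hμ₀ l₂' _ ζ).trans
        (mul_le_mul' cΔ.le (hld₀ (M := M) l₂))) 1 (by rw [ENNReal.coe_one, one_mul]; exact b₈)
    have e₄ := hC μ h (fun z => M'.Γ (z + h) z (DFinsupp.single q.1 (g₁ z q.1)))
      (fun z => M'.Γ (z + h) z (DFinsupp.single q.2 ((f₂ z - g₂ z) q.2)))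
      (fun _ => q.1) (fun _ => q.2) ν _ _ B h₀ hμt
      ((sg₁.single l₁).apply_Γ M' h) (((sf₂.sub sg₂).single l₂).apply_Γ M' h)
      (fun _ _ _ _ => hq₁₂)
      (fun ζ _ => (tΓ'.weightedNorm_single_le h₀ hμ₀ l₁' _ ζ).trans
        (mul_le_mul' cN'.le (hld₀ (M := M') l₁)))
      (fun ζ _ => (tΓ'.weightedNorm_single_le h₀ hμ₀ l₂' _ ζ).trans
        (mul_le_mul' cN'.le (weightedNorm_le_localDist h l₂))) 1
      (by rw [ENNReal.coe_one, one_mul]; exact b₉)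
    exact ((e₁.add e₂ hw hw₀).add e₃ hw hw₀).add e₄ hw hw₀
  refine le_trans (le_of_eq ?_) ((((t₁.add t₂ hw hw₀).add t₃ hw hw₀).add t₄ hw hw₀).add
    (TermBound.sum H hH hw hw₀) hw hw₀).2
  refine weightedNorm_congr (w := parWeight h (η₁ + η₂) γ ν)
    (F := fun z => (P.mulFun γ f₁ f₂ (z + h) - P.mulFun γ g₁ g₂ (z + h)
      - M.Γ (z + h) z (P.mulFun γ f₁ f₂ z) + M'.Γ (z + h) z (P.mulFun γ g₁ g₂ z)) ν)
    (Filter.Eventually.of_forall fun _ => rfl) ?_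
  filter_upwards [sf₁.2, sf₂.2, sg₁.2, sg₂.2] with z m₁ m₂ m₃ m₄
  exact hP.mul_increment_apply (M.mem_G _ _) (M'.mem_G _ _) m₁ m₂ m₃ m₄ hν

theorem aestronglyMeasurable_mulFun {M : Model d r R} {γ₁ γ₂ η₁ η₂ γ T : ℝ} {p₁ p₂ : ℝ≥0∞}
    {f₁ f₂ : SpaceTime d → R.Space} (hf₁ : MemDSector M V₁ γ₁ η₁ T p₁ f₁)
    (hf₂ : MemDSector M V₂ γ₂ η₂ T p₂ f₂) (ν : R.A) :
    AEStronglyMeasurable (fun z => P.mulFun γ f₁ f₂ z ν)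
      (volume.restrict (Ioo 0 T ×ˢ univ)) := by
  have hae : ∀ᵐ z : SpaceTime d ∂volume.restrict (Ioo 0 T ×ˢ univ), z.1 ∈ Ioo 0 T :=
    ae_restrict_of_forall_mem (measurableSet_Ioo.prod MeasurableSet.univ) fun z hz => hz.1
  simp only [mulFun, trunc_apply]
  split_ifs with h
  · exact P.aestronglyMeasurable_mul hf₁.1.measurable (hae.mono fun z hz => hf₁.mem_below hz)
      hf₂.1.measurable (hae.mono fun z hz => hf₂.mem_below hz) ν
  · exact aestronglyMeasurable_const

end SectorProduct

/-! ### The zero map, for the reduction of membership to the difference estimate. -/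

section Zero

variable {d r : ℕ} {R : RegularityStructure.{u}} (M : Model d r R) {γ η T : ℝ} {p : ℝ≥0∞}

theorem dNorm_zero : dNorm M γ η T p 0 = 0 := by
  simp [dNorm, localDist, translNorm]

theorem memDSector_zero {α : ℝ} (V : Sector R α) : MemDSector M V γ η T p 0 :=
  ⟨⟨fun _ => aestronglyMeasurable_const, fun _ _ _ _ => rfl, fun _ _ _ _ _ => rfl, by
    rw [dNorm_zero]; exact ENNReal.zero_lt_top⟩, fun _ _ _ _ => zero_mem _⟩

theorem dDist_zero_right (f : SpaceTime d → R.Space) : dDist M M γ η T p f 0 = dNorm M γ η T p f := by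
  simp [dDist, dNorm, translDist, translNorm]

end Zero

theorem SectorProduct.mulFun_zero {d : ℕ} {R : RegularityStructure.{u}} {α₁ α₂ : ℝ}
    {V₁ : Sector R α₁} {V₂ : Sector R α₂} (P : SectorProduct V₁ V₂) (γ : ℝ) :
    P.mulFun γ (0 : SpaceTime d → R.Space) 0 = 0 := by
  funext z
  ext ν
  simp [mulFun, trunc_apply]

end

theorem theorem3p7 {d r : ℕ} {R : RegularityStructure.{u}} {α₁ α₂ : ℝ}
    (V₁ : Sector R α₁) (V₂ : Sector R α₂) (P : SectorProduct V₁ V₂)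
    (γ₁ γ₂ η₁ η₂ γ η : ℝ) (p₁ p₂ p : ℝ≥0∞) (hp₁ : 1 ≤ p₁) (hp₂ : 1 ≤ p₂)
    (hγ : γ = min (γ₁ + α₂) (γ₂ + α₁)) (hη : η = η₁ + η₂) (hp : p⁻¹ = p₁⁻¹ + p₂⁻¹)
    (hP : P.IsRegular γ) :
    (∀ T : ℝ, 0 < T → ∀ (M : Model d r R) (f₁ f₂ : SpaceTime d → R.Space),
      MemDSector M V₁ γ₁ η₁ T p₁ f₁ → MemDSector M V₂ γ₂ η₂ T p₂ f₂ →
        MemD M γ η T p (P.mulFun γ f₁ f₂)) ∧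
    ∃ C : ℝ≥0, ∀ T : ℝ, 0 < T → ∀ (M M' : Model d r R) (f₁ f₂ g₁ g₂ : SpaceTime d → R.Space),
      MemDSector M V₁ γ₁ η₁ T p₁ f₁ → MemDSector M V₂ γ₂ η₂ T p₂ f₂ →
      MemDSector M' V₁ γ₁ η₁ T p₁ g₁ → MemDSector M' V₂ γ₂ η₂ T p₂ g₂ →
        dDist M M' γ η T p (P.mulFun γ f₁ f₂) (P.mulFun γ g₁ g₂) ≤
          C * (M.normΓ (max γ₁ γ₂) T ^ 2 * localDist γ₁ η₁ T p₁ f₁ g₁ * dNorm M γ₂ η₂ T p₂ f₂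
            + M.distΓ M' (max γ₁ γ₂) T *
                ((M.normΓ (max γ₁ γ₂) T + M'.normΓ (max γ₁ γ₂) T) *
                    dNorm M' γ₁ η₁ T p₁ g₁ * dNorm M γ₂ η₂ T p₂ f₂
                  + dNorm M' γ₂ η₂ T p₂ g₂ * dNorm M γ₁ η₁ T p₁ f₁)
            + dDist M M' γ₁ η₁ T p₁ f₁ g₁ * dNorm M γ₂ η₂ T p₂ f₂
            + M.normΓ (max γ₁ γ₂) T * dNorm M γ₁ η₁ T p₁ f₁ * dDist M M' γ₂ η₂ T p₂ f₂ g₂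
            + (1 + M'.normΓ (max γ₁ γ₂) T ^ 2) *
                dNorm M' γ₁ η₁ T p₁ g₁ * localDist γ₂ η₂ T p₂ f₂ g₂
            + M'.normΓ (max γ₁ γ₂) T * localDist γ₁ η₁ T p₁ f₁ g₁ * dNorm M' γ₂ η₂ T p₂ g₂) := by
  subst hη
  have : ENNReal.HolderTriple p₁ p₂ p := ⟨hp.symm⟩
  obtain ⟨C₁, hC₁⟩ := P.exists_localDist_mulFun_le (d := d) (r := r) γ₁ γ₂ η₁ η₂ γ p₁ p₂ p
  obtain ⟨C₂, hC₂⟩ := P.exists_translDist_mulFun_le (d := d) (r := r) γ₁ γ₂ η₁ η₂ γ p₁ p₂ p hγ hP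
  have main : ∀ (T : ℝ) (M M' : Model d r R) (f₁ f₂ g₁ g₂ : SpaceTime d → R.Space),
      MemDSector M V₁ γ₁ η₁ T p₁ f₁ → MemDSector M V₂ γ₂ η₂ T p₂ f₂ →
      MemDSector M' V₁ γ₁ η₁ T p₁ g₁ → MemDSector M' V₂ γ₂ η₂ T p₂ g₂ →
      dDist M M' γ (η₁ + η₂) T p (P.mulFun γ f₁ f₂) (P.mulFun γ g₁ g₂) ≤
        (C₁ * 2 + C₂ : ℝ≥0) * productBound (M.normΓ (max γ₁ γ₂) T) (M'.normΓ (max γ₁ γ₂) T)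
          (M.distΓ M' (max γ₁ γ₂) T) (localDist γ₁ η₁ T p₁ f₁ g₁) (localDist γ₂ η₂ T p₂ f₂ g₂)
          (dDist M M' γ₁ η₁ T p₁ f₁ g₁) (dDist M M' γ₂ η₂ T p₂ f₂ g₂)
          (dNorm M γ₁ η₁ T p₁ f₁) (dNorm M γ₂ η₂ T p₂ f₂)
          (dNorm M' γ₁ η₁ T p₁ g₁) (dNorm M' γ₂ η₂ T p₂ g₂) := by
    intro T M M' f₁ f₂ g₁ g₂ hf₁ hf₂ hg₁ hg₂
    set B := productBound _ _ _ _ _ _ _ _ _ _ _ with hB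
    obtain ⟨b₁, b₂, -⟩ := terms_le_productBound _ _ _ _ _ _ _ _ _ _ _ hB
    have h₁ := hC₁ T M M' f₁ f₂ g₁ g₂ hf₁ hf₂ hg₁ hg₂
    have h₂ := hC₂ T M M' f₁ f₂ g₁ g₂ hf₁ hf₂ hg₁ hg₂
    rw [ENNReal.coe_add, add_mul]
    refine add_le_add (h₁.trans ?_) h₂
    rw [ENNReal.coe_mul, mul_assoc, ENNReal.coe_ofNat, two_mul]
    gcongr
    · exact (mul_le_mul' le_self_add le_self_add).trans b₁
    · exact (mul_le_mul' le_self_add le_rfl).trans b₂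
  refine ⟨fun T _ M f₁ f₂ hf₁ hf₂ => ⟨P.aestronglyMeasurable_mulFun hf₁ hf₂, ?_, ?_, ?_⟩,
    C₁ * 2 + C₂, fun T _ M M' f₁ f₂ g₁ g₂ => main T M M' f₁ f₂ g₁ g₂⟩
  · intro t ht x k
    simp only [SectorProduct.mulFun, hf₁.1.periodic t ht x k, hf₂.1.periodic t ht x k]
  · intro t _ x ζ hζ
    rw [SectorProduct.mulFun, RegularityStructure.trunc_apply, if_neg (not_lt.2 hζ)]
  -- Comparison with zero under the same model turns the distance into the norm of the product, and
  -- every term left on the right is finite.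
  · have h := main T M M f₁ f₂ 0 0 hf₁ hf₂ (memDSector_zero M V₁) (memDSector_zero M V₂)
    rw [P.mulFun_zero, dDist_zero_right, dDist_zero_right, dDist_zero_right, dNorm_zero,
      dNorm_zero] at h
    refine h.trans_lt (ENNReal.mul_lt_top ENNReal.coe_lt_top ?_)
    have hN := M.normΓ_ne_top (c := max γ₁ γ₂) T
    have hΔ := M.distΓ_ne_top M (c := max γ₁ γ₂) T
    have hf₁' := hf₁.1.norm_lt_top.ne
    have hf₂' := hf₂.1.norm_lt_top.ne
    have hl₁ := ne_top_of_le_ne_top hf₁' (le_self_add (a := localDist γ₁ η₁ T p₁ f₁ 0))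
    rw [productBound, lt_top_iff_ne_top]
    simp only [mul_zero, zero_mul, add_zero]
    finiteness
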